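/- Let $K$ be an algebraically closed field, let $n\ge 0$ be an integer such that the characteristic of $K$ is $0$ or greater than $n$, and let $A$ be an $n\times n$ matrix over $K$. The spectrum of a matrix is the multiset of its eigenvalues, counted with algebraic multiplicity; two matrices are isospectral if their spectra agree. For $N\subseteq\{1,\dots,n\}$ let $A_N$ be the submatrix of $A$ with rows and columns indexed by $N$; the $k\times k$ principal minors of $A$ are the determinants $\det(A_N)$ with $|N|=k$. We say that $A$ has symmetrized principal minors if, for every $k$, all $k\times k$ principal minors of $A$ are equal. Write $$\det\bigl(A+\operatorname{diag}(v_1,\dots,v_n)-\lambda I\bigr)=\sum_{i=0}^n C_i(v)(-\lambda)^{n-i},\qquad C_i\in K[v_1,\dots,v_n],$$ and let $E_A=(S_1,\dots,S_n)\subseteq K[v_1,\dots,v_n]$, where $S_i=C_i(v)-C_i(0)$ for $1\le i\le n$, be the ideal of spectral invariants of $A$. Then: (1) There exists a nonzero diagonal matrix $D$ over $K$ such that $A$ and $A+D$ are isospectral if and only if, for some $k$, the $k\times k$ principal minors of $A$ are not all equal. (2) The common zero set of $E_A$ in $K^n$ is $\{0\}$ if and only if $A$ has symmetrized principal minors. 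-/

import Mathlib

noncomputable section

namespace SpectralRigidity

/-- The spectrum of a square matrix over an algebraically closed field: the multiset of its
eigenvalues, counted with algebraic multiplicity. -/
def spectrumMultiset {K : Type*} [Field K] {n : ℕ} (A : Matrix (Fin n) (Fin n) K) : Multiset K :=
  A.charpoly.roots

/-- Two matrices are isospectral if they have the same spectrum (with multiplicities). -/
def Isospectral {K : Type*} [Field K] {n : ℕ} (A B : Matrix (Fin n) (Fin n) K) : Prop :=
  spectrumMultiset A = spectrumMultiset B

/-- The principal minor `det (A_N)` on the rows and columns indexed by `N`. -/
def principalMinor {K : Type*} [Field K] {n : ℕ} (A : Matrix (Fin n) (Fin n) K)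
    (N : Finset (Fin n)) : K :=
  (A.submatrix (fun i : N => (i : Fin n)) (fun i : N => (i : Fin n))).det

/-- For the given size `k`, all `k × k` principal minors of `A` are equal. -/
def PrincipalMinorsEqual {K : Type*} [Field K] {n : ℕ} (A : Matrix (Fin n) (Fin n) K)
    (k : ℕ) : Prop :=
  ∀ N M : Finset (Fin n), N.card = k → M.card = k → principalMinor A N = principalMinor A M

/-- `A` has symmetrized principal minors: principal minors of equal size have the same value. -/
def HasSymmetrizedPrincipalMinors {K : Type*} [Field K] {n : ℕ}
    (A : Matrix (Fin n) (Fin n) K) : Prop :=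
  ∀ k : ℕ, PrincipalMinorsEqual A k

/-- The matrix `A + diag(v₁, …, vₙ)` over the polynomial ring `K[v₁, …, vₙ]`. -/
def genericShift {K : Type*} [Field K] {n : ℕ} (A : Matrix (Fin n) (Fin n) K) :
    Matrix (Fin n) (Fin n) (MvPolynomial (Fin n) K) :=
  A.map MvPolynomial.C + Matrix.diagonal MvPolynomial.X

/-- The coefficient `Cᵢ(v)` in `det (A + diag(v) - λ I) = ∑ᵢ Cᵢ(v) (-λ)ⁿ⁻ⁱ`, for `i ≤ n`.
Since Mathlib's `charpoly` is `det (λ I - ·) = (-1)ⁿ det (· - λ I)`, the sign is `(-1)ⁱ`. -/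
def charCoeff {K : Type*} [Field K] {n : ℕ} (A : Matrix (Fin n) (Fin n) K) (i : ℕ) :
    MvPolynomial (Fin n) K :=
  (-1) ^ i * (genericShift A).charpoly.coeff (n - i)

/-- The spectral invariant `Sᵢ = Cᵢ(v) - Cᵢ(0)`, for `1 ≤ i ≤ n`. -/
def spectralInvariant {K : Type*} [Field K] {n : ℕ} (A : Matrix (Fin n) (Fin n) K) (i : ℕ) :
    MvPolynomial (Fin n) K :=
  charCoeff A i - MvPolynomial.C (MvPolynomial.eval (0 : Fin n → K) (charCoeff A i))

/-- The ideal of spectral invariants `(S₁, …, Sₙ)` of `A`. -/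
def spectralIdeal {K : Type*} [Field K] {n : ℕ} (A : Matrix (Fin n) (Fin n) K) :
    Ideal (MvPolynomial (Fin n) K) :=
  Ideal.span (spectralInvariant A '' Set.Icc 1 n)

end SpectralRigidity

end

/-! Expanding the determinant by rows, the characteristic polynomial of `A + diag x` is the sum over
subsets `N` of the signed minor of `N` times `∏_{l ∉ N} (X - x_l)` (`charpoly_add_diagonal`). Both
claims reduce to `charpoly_rigid_iff`, about the `x` for which this polynomial equals that of `A`.

If the signed minors of each size `m` have a common value `μ_m`, the sum is `T = ∑ μ_m ∂^[m]` (Hasse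
derivatives) applied to `∏ (X - x_l)`. Since `μ_0 = 1` and derivatives lower degrees, `T` is
invertible, so isospectrality forces `∏ (X - x_l) = X^n`, that is `x = 0`.

Conversely let `x = 0` be the only solution, and let the minors of size below `k` be symmetrized.
Write each signed minor of size `k` as the mean plus a deviation `δ_N`. Undoing `T` (truncated at
`k`) on the difference of the characteristic polynomials of `A + diag v` and `A` gives `n`
polynomials `g_i = e_i + G_i + lower terms`, where the `e_i` are the coefficients of `∏ (X - v_l)`
and `G_i`, linear in `δ`, lies `k` degrees lower. Their only possible common zero is the origin.

`K[v]` is free of rank `n!` over `K[e]`, and the same homogeneous basis works over `K[g]`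
(`combine_deformed_bijective`). By the Nullstellensatz, multiplication by an `f` with `f(0) = 0` is
nilpotent on `K[v]/(g)`, so has trace zero. For `f` homogeneous of degree `k`, this trace is also
minus the constant term of a first order variation, and that variation is `∑_σ σ(D f)`, where `D` is
the rational vector field with `D e_i = G_i` (`sum_coord_tangentMap`). For `f = ∏_{l ∈ M} v_l`,
Lagrange interpolation and averaging over permutations evaluate the sum as `±n! δ_M`
(`sum_permFrac_deviationField`). As `n!` is invertible, every `δ_M` vanishes. -/

namespace MvPolynomial

open Finset

/-! ### The weight filtration and operators that are the identity up to lower weight. -/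

section WeightFiltration

variable {K σ : Type*} [CommRing K] (w : σ → ℤ)

/-- The polynomials all of whose monomials have `w`-weight at most `d`. -/
def weightLE (d : ℤ) : Submodule K (MvPolynomial σ K) where
  carrier := {p | ∀ s, p.coeff s ≠ 0 → Finsupp.weight w s ≤ d}
  add_mem' := by
    intro p q hp hq s hs
    by_cases h : p.coeff s = 0
    · exact hq s (fun h' => hs (by rw [coeff_add, h, h', add_zero]))
    · exact hp s h
  zero_mem' := by intro s hs; simp at hs
  smul_mem' := by
    intro c p hp s hs
    exact hp s (fun h => hs (by rw [coeff_smul, h, smul_zero]))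

variable {w}

theorem mem_weightLE {d : ℤ} {p : MvPolynomial σ K} :
    p ∈ weightLE w d ↔ ∀ s, p.coeff s ≠ 0 → Finsupp.weight w s ≤ d := Iff.rfl

theorem weightLE_mono {d d' : ℤ} (h : d ≤ d') {p : MvPolynomial σ K} (hp : p ∈ weightLE w d) :
    p ∈ weightLE w d' := fun s hs => (hp s hs).trans h

theorem IsWeightedHomogeneous.mem_weightLE {d : ℤ} {p : MvPolynomial σ K}
    (hp : IsWeightedHomogeneous w p d) : p ∈ weightLE w d := fun _ hs => (hp hs).le

theorem mul_mem_weightLE {d d' : ℤ} {p q : MvPolynomial σ K} (hp : p ∈ weightLE w d)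
    (hq : q ∈ weightLE w d') : p * q ∈ weightLE w (d + d') := by
  classical
  intro s hs
  rw [coeff_mul] at hs
  obtain ⟨⟨a, b⟩, hab, h⟩ := Finset.exists_ne_zero_of_sum_ne_zero hs
  rw [Finset.HasAntidiagonal.mem_antidiagonal] at hab
  have ha := hp a (left_ne_zero_of_mul h)
  have hb := hq b (right_ne_zero_of_mul h)
  rw [← hab, map_add]
  exact add_le_add ha hb

theorem mem_weightLE_iff_component {d : ℤ} {p : MvPolynomial σ K} :
    p ∈ weightLE w d ↔ ∀ j, d < j → weightedHomogeneousComponent w j p = 0 := by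
  classical
  constructor
  · intro hp j hj
    apply weightedHomogeneousComponent_eq_zero'
    intro s hs h
    have := hp s (mem_support_iff.mp hs)
    omega
  · intro h s hs
    by_contra hlt
    have := congrArg (coeff s) (h _ (not_le.mp hlt))
    rw [coeff_weightedHomogeneousComponent, if_pos rfl, coeff_zero] at this
    exact hs this

theorem exists_mem_weightLE (p : MvPolynomial σ K) : ∃ d : ℤ, p ∈ weightLE w d := by
  classical
  obtain ⟨d, hd⟩ := (p.support.image (Finsupp.weight w)).bddAbove
  exact ⟨d, fun s hs => hd (by
    exact mem_coe.mpr (mem_image_of_mem _ (mem_support_iff.mpr hs)))⟩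

theorem eq_zero_of_mem_weightLE_of_neg (hw : ∀ i, 0 ≤ w i) {d : ℤ} (hd : d < 0)
    {p : MvPolynomial σ K} (hp : p ∈ weightLE w d) : p = 0 := by
  ext s
  rw [coeff_zero]
  by_contra h
  have h1 := hp s h
  have h2 : 0 ≤ Finsupp.weight w s := by
    rw [Finsupp.weight_apply]
    exact Finsupp.sum_nonneg fun i _ => nsmul_nonneg (hw i) _
  omega

theorem C_mem_weightLE (c : K) : (C c : MvPolynomial σ K) ∈ weightLE w 0 :=
  (isWeightedHomogeneous_C w c).mem_weightLE

theorem weightLE_induction {d : ℤ} {p : MvPolynomial σ K} (hp : p ∈ weightLE w d)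
    {S : Submodule K (MvPolynomial σ K)}
    (h : ∀ s, Finsupp.weight w s ≤ d → monomial s (1 : K) ∈ S) : p ∈ S := by
  rw [p.as_sum]
  refine S.sum_mem fun s hs => ?_
  have : monomial s (coeff s p) = coeff s p • monomial s (1 : K) := by
    rw [smul_monomial, smul_eq_mul, mul_one]
  rw [this]
  exact S.smul_mem _ (h s (hp s (mem_support_iff.mp hs)))

/-- A linear endomorphism which is the identity up to terms of smaller weight is injective. -/
theorem injective_of_sub_mem_weightLE (hw : ∀ i, 0 ≤ w i)
    (T : MvPolynomial σ K →ₗ[K] MvPolynomial σ K)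
    (hT : ∀ d p, p ∈ weightLE w d → T p - p ∈ weightLE w (d - 1)) : Function.Injective T := by
  rw [injective_iff_map_eq_zero]
  intro p hp
  obtain ⟨d, hd⟩ := exists_mem_weightLE (w := w) p
  -- If `T p = 0`, then `p` is minus its own error term, so it descends one step at a time until the
  -- weight bound is negative.
  have key : ∀ m : ℕ, p ∈ weightLE w (d - m) := by
    intro m
    induction m with
    | zero => simpa using hd
    | succ m ih =>
      have := hT _ _ ih
      rw [hp, zero_sub, Submodule.neg_mem_iff] at this
      refine weightLE_mono ?_ this
      push_cast
      omega
  refine eq_zero_of_mem_weightLE_of_neg hw ?_ (key (d.toNat + 1))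
  push_cast
  omega

/-- A linear endomorphism which is the identity up to terms of smaller weight is surjective on
each step of the weight filtration. -/
theorem exists_eq_of_sub_mem_weightLE (hw : ∀ i, 0 ≤ w i)
    (T : MvPolynomial σ K →ₗ[K] MvPolynomial σ K)
    (hT : ∀ d p, p ∈ weightLE w d → T p - p ∈ weightLE w (d - 1)) (d : ℤ)
    (p : MvPolynomial σ K) (hp : p ∈ weightLE w d) : ∃ q ∈ weightLE w d, T q = p := by
  obtain ⟨m, hm⟩ : ∃ m : ℕ, d < m := ⟨d.toNat + 1, by push_cast; omega⟩
  induction m generalizing d p with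
  | zero => exact ⟨0, zero_mem _, by
      rw [map_zero, eq_zero_of_mem_weightLE_of_neg hw (by simpa using hm) hp]⟩
  | succ m ih =>
    -- The error `T p - p` lies one step lower, where it already has a preimage; subtracting that
    -- preimage corrects `p`.
    obtain ⟨q, hq, hqT⟩ := ih (d - 1) (T p - p) (hT d p hp) (by push_cast at hm; omega)
    refine ⟨p - q, sub_mem hp (weightLE_mono (by omega) hq), ?_⟩
    rw [map_sub, hqT]
    ring

end WeightFiltration

end MvPolynomial

namespace ArtinBasis

open Finset

/-! ### Spanning by Artin monomials over the coefficients of the product of linear factors. -/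

section Tower

open Polynomial

variable {A : Type*} [CommRing A] (v : ℕ → A) (n : ℕ)

/-- The Artin monomials `∏_{l < j} v_l ^ a_l` with `a_l < n - l`. -/
def artinMonomials [DecidableEq A] : ℕ → Finset A
  | 0 => {1}
  | j + 1 => Finset.image₂ (fun i m => v j ^ i * m) (range (n - j)) (artinMonomials j)

/-- Only this upper bound, `n!` for `j = n`, is needed; that the monomials are distinct plays no
role. -/
theorem card_artinMonomials_le [DecidableEq A] (j : ℕ) :
    (artinMonomials v n j).card ≤ n.descFactorial j := by
  induction j with
  | zero => simp [artinMonomials]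
  | succ j ih =>
    rw [artinMonomials, Nat.descFactorial_succ]
    refine (Finset.card_image₂_le _ _ _).trans ?_
    rw [card_range]
    exact Nat.mul_le_mul_left _ ih

/-- The product of the factors `X - v_l` with `j ≤ l < n`. -/
noncomputable def tailPoly (j : ℕ) : A[X] := ∏ l ∈ Ico j n, (X - C (v l))

theorem tailPoly_monic (j : ℕ) : (tailPoly v n j).Monic :=
  monic_prod_of_monic _ _ fun _ _ => monic_X_sub_C _

theorem tailPoly_natDegree [Nontrivial A] (j : ℕ) : (tailPoly v n j).natDegree = n - j := by
  rw [tailPoly, natDegree_prod_of_monic _ _ fun _ _ => monic_X_sub_C _]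
  simp

theorem tailPoly_eq {j : ℕ} (hj : j < n) :
    tailPoly v n j = (X - C (v j)) * tailPoly v n (j + 1) :=
  Finset.prod_eq_prod_Ico_succ_bot hj _

variable (S : Subring A) (hS : ∀ i, (tailPoly v n 0).coeff i ∈ S)

-- This is synthetic division: dividing by `X - v_j` expresses each coefficient of the quotient
-- through the next higher one, `v_j`, and a coefficient of the dividend.
include hS in
theorem coeff_tailPoly_mem (j : ℕ) (hj : j ≤ n) (i : ℕ) :
    (tailPoly v n j).coeff i ∈ Algebra.adjoin S (v '' Set.Iio j) := by
  induction j generalizing i with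
  | zero => exact Subalgebra.algebraMap_mem _ (⟨_, hS i⟩ : S)
  | succ j ih =>
    have hmono : Algebra.adjoin S (v '' Set.Iio j) ≤ Algebra.adjoin S (v '' Set.Iio (j + 1)) :=
      Algebra.adjoin_mono (Set.image_mono (Set.Iio_subset_Iio j.le_succ))
    have hv : v j ∈ Algebra.adjoin S (v '' Set.Iio (j + 1)) :=
      Algebra.subset_adjoin ⟨j, j.lt_succ_self, rfl⟩
    have hrec : ∀ i, (tailPoly v n (j + 1)).coeff i =
        (tailPoly v n j).coeff (i + 1) + v j * (tailPoly v n (j + 1)).coeff (i + 1) := by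
      intro i
      rw [tailPoly_eq v n hj, sub_mul, coeff_sub, coeff_X_mul, coeff_C_mul]
      ring
    -- Descending induction on `i`, with `m` measuring the distance to the range where the
    -- coefficients vanish.
    have key : ∀ m i, (tailPoly v n (j + 1)).natDegree < i + m →
        (tailPoly v n (j + 1)).coeff i ∈ Algebra.adjoin S (v '' Set.Iio (j + 1)) := by
      intro m
      induction m with
      | zero =>
        intro i hi
        rw [coeff_eq_zero_of_natDegree_lt (by simpa using hi)]
        exact zero_mem _
      | succ m ihm =>
        intro i hi
        rw [hrec]
        exact add_mem (hmono (ih (by omega) _)) (mul_mem hv (ihm _ (by omega)))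
    exact key ((tailPoly v n (j + 1)).natDegree + 1) i (by omega)

theorem mul_mem_span_succ [DecidableEq A] {j i : ℕ} (hi : i < n - j) {m : A}
    (hm : m ∈ Submodule.span S (artinMonomials v n j : Set A)) :
    v j ^ i * m ∈ Submodule.span S (artinMonomials v n (j + 1) : Set A) := by
  induction hm using Submodule.span_induction with
  | mem x hx =>
    apply Submodule.subset_span
    rw [mem_coe, artinMonomials, mem_image₂]
    exact ⟨i, mem_range.mpr hi, x, hx, rfl⟩
  | zero => simp
  | add x y _ _ hx hy => rw [mul_add]; exact add_mem hx hy
  | smul a x _ hx => rw [mul_smul_comm]; exact Submodule.smul_mem _ _ hx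

-- `v_j` is a root of `tailPoly v n j`, which is monic of degree `n - j` with coefficients in the
-- algebra generated by the earlier `v_l`. So `v_j ^ (n - j)` reduces to smaller exponents of `v_j`,
-- and the induction on `j` absorbs the coefficients.
include hS in
theorem mul_mem_span [DecidableEq A] (j : ℕ) (hj : j ≤ n) {a : A}
    (ha : a ∈ Algebra.adjoin S (v '' Set.Iio j)) {m : A}
    (hm : m ∈ Submodule.span S (artinMonomials v n j : Set A)) :
    a * m ∈ Submodule.span S (artinMonomials v n j : Set A) := by
  nontriviality A
  induction j generalizing a m with
  | zero =>
    have h0 : v '' Set.Iio 0 = ∅ := by simp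
    rw [h0, Algebra.adjoin_empty, Algebra.mem_bot] at ha
    obtain ⟨s, rfl⟩ := ha
    rw [← Algebra.smul_def]
    exact Submodule.smul_mem _ _ hm
  | succ j ih =>
    induction ha using Algebra.adjoin_induction generalizing m with
    | algebraMap s => rw [← Algebra.smul_def]; exact Submodule.smul_mem _ _ hm
    | add x y _ _ hx hy => rw [add_mul]; exact add_mem (hx hm) (hy hm)
    | mul x y _ _ hx hy => rw [mul_assoc]; exact hx (hy hm)
    | mem x hx =>
      obtain ⟨l, hl, rfl⟩ := hx
      induction hm using Submodule.span_induction with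
      | zero => simp
      | add x y _ _ hx hy => rw [mul_add]; exact add_mem hx hy
      | smul a x _ hx => rw [mul_smul_comm]; exact Submodule.smul_mem _ _ hx
      | mem x hx =>
        rw [mem_coe, artinMonomials, mem_image₂] at hx
        obtain ⟨i, hi, m, hm, rfl⟩ := hx
        rw [mem_range] at hi
        have hm' : m ∈ Submodule.span S (artinMonomials v n j : Set A) := Submodule.subset_span hm
        rcases Nat.lt_succ_iff_lt_or_eq.mp hl with hlj | rfl
        · rw [mul_left_comm]
          exact mul_mem_span_succ v n S hi
            (ih (by omega) (Algebra.subset_adjoin ⟨l, hlj, rfl⟩) hm')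
        · rw [← mul_assoc, ← pow_succ']
          by_cases hi' : i + 1 < n - l
          · exact mul_mem_span_succ v n S hi' hm'
          · have hdeg : i + 1 = n - l := by omega
            have hroot : (tailPoly v n l).eval (v l) = 0 := by
              rw [tailPoly_eq v n hj]
              simp
            rw [eval_eq_sum_range, tailPoly_natDegree, sum_range_succ] at hroot
            have hlead : (tailPoly v n l).coeff (n - l) = 1 := by
              have := tailPoly_monic v n l
              rwa [Monic, leadingCoeff, tailPoly_natDegree] at this
            rw [hlead, one_mul] at hroot
            rw [hdeg, eq_neg_of_add_eq_zero_right hroot, neg_mul, Submodule.neg_mem_iff, sum_mul]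
            refine sum_mem fun t ht => ?_
            rw [mul_comm (coeff _ _), mul_assoc]
            exact mul_mem_span_succ v n S (mem_range.mp ht)
              (ih (by omega) (coeff_tailPoly_mem v n S hS l (by omega) t) hm')

theorem one_mem_artinMonomials [DecidableEq A] (j : ℕ) (hj : j ≤ n) :
    1 ∈ artinMonomials v n j := by
  induction j with
  | zero => simp [artinMonomials]
  | succ j ih =>
    rw [artinMonomials, mem_image₂]
    exact ⟨0, mem_range.mpr (by omega), 1, ih (by omega), by simp⟩

include hS in
/-- The Artin monomials span the algebra generated by the roots over the ring of coefficients. -/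
theorem adjoin_le_span_artinMonomials [DecidableEq A] {a : A}
    (ha : a ∈ Algebra.adjoin S (v '' Set.Iio n)) :
    a ∈ Submodule.span S (artinMonomials v n n : Set A) := by
  rw [← mul_one a]
  exact mul_mem_span v n S hS n le_rfl ha
    (Submodule.subset_span (one_mem_artinMonomials v n n le_rfl))

end Tower

/-! ### A homogeneous spanning family indexed by permutations. -/

section Spanning

open MvPolynomial

variable (K : Type*) [Field K] (n : ℕ)

/-- The polynomial `∏ l, (X - v_l)` over `K[v]`. -/
noncomputable def rootPoly : Polynomial (MvPolynomial (Fin n) K) :=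
  ∏ l, (Polynomial.X - Polynomial.C (MvPolynomial.X l))

/-- The coefficients of `∏ l, (X - v_l)`: up to sign, the elementary symmetric polynomials. -/
noncomputable def elem (i : Fin n) : MvPolynomial (Fin n) K := (rootPoly K n).coeff i

theorem rootPoly_monic : (rootPoly K n).Monic :=
  Polynomial.monic_prod_of_monic _ _ fun _ _ => Polynomial.monic_X_sub_C _

theorem rootPoly_natDegree : (rootPoly K n).natDegree = n := by
  rw [rootPoly, Polynomial.natDegree_prod_of_monic _ _ fun _ _ => Polynomial.monic_X_sub_C _]
  simp

theorem coeff_rootPoly_mem (i : ℕ) : (rootPoly K n).coeff i ∈ (aeval (R := K) (elem K n)).range := by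
  rcases lt_trichotomy i n with h | rfl | h
  · exact ⟨X ⟨i, h⟩, by simp [elem]⟩
  · have := rootPoly_monic K i
    rw [Polynomial.Monic, Polynomial.leadingCoeff, rootPoly_natDegree] at this
    rw [this]
    exact one_mem _
  · rw [Polynomial.coeff_eq_zero_of_natDegree_lt (by rwa [rootPoly_natDegree])]
    exact zero_mem _

/-- Indexing by permutations makes the matrix of conjugates of `b` square. Repetitions in `b` are
harmless here; `combine_bijective` excludes them afterwards. -/
theorem exists_spanning_family : ∃ (b : Equiv.Perm (Fin n) → MvPolynomial (Fin n) K)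
    (d : Equiv.Perm (Fin n) → ℤ),
    (∀ α, IsWeightedHomogeneous (fun _ => (1 : ℤ)) (b α) (d α)) ∧
    ∀ h, ∃ P : Equiv.Perm (Fin n) → MvPolynomial (Fin n) K,
      h = ∑ β, aeval (elem K n) (P β) * b β := by
  classical
  set v : ℕ → MvPolynomial (Fin n) K := fun j => if h : j < n then X ⟨j, h⟩ else 0 with hv
  have hvX : ∀ l : Fin n, v l = X l := fun l => by simp [hv]
  set T := artinMonomials v n n with hT
  have hhom : ∀ j ≤ n, ∀ m ∈ artinMonomials v n j,
      ∃ d : ℤ, IsWeightedHomogeneous (fun _ => (1 : ℤ)) m d := by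
    intro j
    induction j with
    | zero =>
      intro _ m hm
      rw [artinMonomials, mem_singleton] at hm
      exact ⟨0, hm ▸ isWeightedHomogeneous_one K _⟩
    | succ j ih =>
      intro hj m hm
      rw [artinMonomials, mem_image₂] at hm
      obtain ⟨i, -, m, hm, rfl⟩ := hm
      obtain ⟨d, hd⟩ := ih (by omega) m hm
      have h1 : v j = X ⟨j, hj⟩ := hvX ⟨j, hj⟩
      have h2 : IsWeightedHomogeneous (fun _ => (1 : ℤ)) (v j) 1 := by
        rw [h1]
        exact isWeightedHomogeneous_X K _ _
      exact ⟨_, (h2.pow i).mul hd⟩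
  have hcard : Fintype.card T ≤ Fintype.card (Equiv.Perm (Fin n)) := by
    rw [Fintype.card_coe, Fintype.card_perm, Fintype.card_fin, ← Nat.descFactorial_self]
    exact card_artinMonomials_le v n n
  obtain ⟨ι⟩ := Function.Embedding.nonempty_of_card_le hcard
  have : Nonempty T := ⟨⟨1, one_mem_artinMonomials v n n le_rfl⟩⟩
  set b : Equiv.Perm (Fin n) → T := Function.invFun ι
  have hb : Function.Surjective b := Function.invFun_surjective ι.injective
  have hd : ∀ α, ∃ d : ℤ, IsWeightedHomogeneous (fun _ => (1 : ℤ))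
      (b α : MvPolynomial (Fin n) K) d := fun α => hhom n le_rfl _ (b α).2
  choose d hd using hd
  refine ⟨fun α => b α, d, hd, fun h => ?_⟩
  set S : Subring (MvPolynomial (Fin n) K) := (aeval (R := K) (elem K n)).range.toSubring
  have htail : tailPoly v n 0 = rootPoly K n := by
    rw [tailPoly, rootPoly, ← range_eq_Ico, ← Fin.prod_univ_eq_prod_range
      (fun l => Polynomial.X - Polynomial.C (v l))]
    simp only [hvX]
  have hS : ∀ i, (tailPoly v n 0).coeff i ∈ S := by
    intro i
    rw [htail]
    exact coeff_rootPoly_mem K n i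
  have hmem : h ∈ Algebra.adjoin S (v '' Set.Iio n) := by
    induction h using MvPolynomial.induction_on with
    | C c =>
      exact Subalgebra.algebraMap_mem _ (⟨C c, ⟨C c, by simp [algebraMap_eq]⟩⟩ : S)
    | add p q hp hq => exact add_mem hp hq
    | mul_X p i hp => exact mul_mem hp (Algebra.subset_adjoin ⟨i, i.2, hvX i⟩)
  have hspan := adjoin_le_span_artinMonomials v n S hS hmem
  have himg : (T : Set (MvPolynomial (Fin n) K)) = Set.range fun α => (b α : MvPolynomial (Fin n) K) := by
    ext x
    constructor
    · intro hx
      obtain ⟨α, hα⟩ := hb ⟨x, hx⟩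
      exact ⟨α, by simp [hα]⟩
    · rintro ⟨α, rfl⟩
      exact (b α).2
  rw [← hT, himg, Submodule.mem_span_range_iff_exists_fun] at hspan
  obtain ⟨c, hc⟩ := hspan
  choose P hP using fun α => (c α).2
  refine ⟨P, ?_⟩
  rw [← hc]
  refine sum_congr rfl fun α _ => ?_
  have : aeval (elem K n) (P α) = (c α : MvPolynomial (Fin n) K) := hP α
  rw [this]
  rfl

end Spanning

open MvPolynomial

/-! ### Algebraic independence of the symmetric coefficients; the action of permutations. -/

section Independence

variable (K : Type*) [Field K] (n : ℕ)

theorem elem_eq_esymm (i : Fin n) :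
    elem K n i = (-1) ^ (n - i : ℕ) * esymm (Fin n) K (n - i) := by
  have h := Multiset.prod_X_sub_C_coeff
    (univ.val.map (X : Fin n → MvPolynomial (Fin n) K)) (k := i) (by simp)
  rw [Multiset.map_map, Multiset.card_map, card_val, card_univ, Fintype.card_fin,
    ← esymm_eq_multiset_esymm] at h
  exact h

theorem aeval_elem_injective : Function.Injective (aeval (R := K) (elem K n)) := by
  -- `elem K n i` is `esymm` of degree `n - i` up to sign, whereas the fundamental theorem on
  -- symmetric polynomials pairs `X i` with degree `i + 1`. `τ` reverses the indices and inserts the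
  -- signs; `τ'` undoes it.
  set τ : MvPolynomial (Fin n) K →ₐ[K] MvPolynomial (Fin n) K :=
    aeval fun i => (-1) ^ (n - i : ℕ) * X i.rev with hτ
  set τ' : MvPolynomial (Fin n) K →ₐ[K] MvPolynomial (Fin n) K :=
    aeval fun i => (-1) ^ (i + 1 : ℕ) * X i.rev with hτ'
  have hrev : ∀ i : Fin n, (i.rev : ℕ) + 1 = n - i := fun i => by rw [Fin.val_rev]; omega
  have hττ : τ'.comp τ = AlgHom.id K _ := by
    apply MvPolynomial.algHom_ext
    intro i
    rw [AlgHom.comp_apply, hτ, aeval_X, map_mul, map_pow, map_neg, map_one, hτ', aeval_X, hrev,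
      ← mul_assoc, ← pow_add, Even.neg_one_pow ⟨_, rfl⟩, one_mul, Fin.rev_rev]
    rfl
  have hinj : Function.Injective τ := by
    intro p q h
    have := congrArg τ' h
    rwa [← AlgHom.comp_apply, ← AlgHom.comp_apply, hττ] at this
  have hcomp : aeval (R := K) (elem K n) =
      (aeval fun i : Fin n => esymm (Fin n) K (i + 1)).comp τ := by
    apply MvPolynomial.algHom_ext
    intro i
    rw [aeval_X, AlgHom.comp_apply, hτ, aeval_X, map_mul, map_pow, map_neg, map_one, aeval_X,
      hrev, elem_eq_esymm]
  rw [hcomp]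
  intro p q h
  apply hinj
  apply esymmAlgHom_fin_injective K (le_refl n)
  apply Subtype.ext
  rw [esymmAlgHom_apply, esymmAlgHom_apply]
  exact h

theorem rename_elem (σ : Equiv.Perm (Fin n)) (i : Fin n) :
    rename σ (elem K n i) = elem K n i := by
  have h : (rootPoly K n).map (rename (R := K) σ).toRingHom = rootPoly K n := by
    rw [rootPoly, Polynomial.map_prod]
    refine Fintype.prod_equiv σ _ _ fun l => ?_
    simp
  rw [elem]
  conv_rhs => rw [← h, Polynomial.coeff_map]
  rfl

theorem rename_aeval_elem (σ : Equiv.Perm (Fin n)) (p : MvPolynomial (Fin n) K) :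
    rename σ (aeval (elem K n) p) = aeval (elem K n) p := by
  have : (rename (R := K) σ).comp (aeval (elem K n)) = aeval (elem K n) := by
    apply MvPolynomial.algHom_ext
    intro i
    rw [AlgHom.comp_apply, aeval_X, rename_elem]
  exact DFunLike.congr_fun this p

/-- The field of rational functions in `n` variables. -/
abbrev RatFun := FractionRing (MvPolynomial (Fin n) K)

/-- The action of a permutation of the variables on the field of rational functions. -/
noncomputable def permFrac (σ : Equiv.Perm (Fin n)) :
    RatFun K n ≃+* RatFun K n :=
  IsFractionRing.ringEquivOfRingEquiv (renameEquiv K σ).toRingEquiv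

theorem permFrac_algebraMap (σ : Equiv.Perm (Fin n)) (p : MvPolynomial (Fin n) K) :
    permFrac K n σ (algebraMap _ _ p) = algebraMap _ _ (rename σ p) :=
  IsFractionRing.ringEquivOfRingEquiv_algebraMap _ _

end Independence

/-! ### Freeness of the polynomial ring over the symmetric coefficients. -/

section Coordinates

variable {K : Type*} [Field K] {n : ℕ}

/-- The map sending a family `P` of polynomials to `∑ β, P_β(g) b_β`. -/
noncomputable def combine {ι : Type*} [Fintype ι] (g : Fin n → MvPolynomial (Fin n) K)
    (b : ι → MvPolynomial (Fin n) K) :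
    (ι → MvPolynomial (Fin n) K) →ₗ[K] MvPolynomial (Fin n) K :=
  ∑ β, (LinearMap.mulRight K (b β)) ∘ₗ (aeval (R := K) g).toLinearMap ∘ₗ LinearMap.proj β

theorem combine_apply {ι : Type*} [Fintype ι] (g : Fin n → MvPolynomial (Fin n) K)
    (b : ι → MvPolynomial (Fin n) K) (P : ι → MvPolynomial (Fin n) K) :
    combine g b P = ∑ β, aeval g (P β) * b β := by
  simp [combine]

/-- The matrix of all conjugates of the family `b`. -/
noncomputable def conjMatrix (b : Equiv.Perm (Fin n) → MvPolynomial (Fin n) K) :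
    Matrix (Equiv.Perm (Fin n)) (Equiv.Perm (Fin n)) (RatFun K n) :=
  Matrix.of fun α σ => algebraMap _ _ (rename σ (b α))

variable (b : Equiv.Perm (Fin n) → MvPolynomial (Fin n) K)

theorem rename_combine (σ : Equiv.Perm (Fin n)) (P : Equiv.Perm (Fin n) → MvPolynomial (Fin n) K) :
    algebraMap _ (RatFun K n) (rename σ (combine (elem K n) b P)) =
      ∑ β, algebraMap _ _ (aeval (elem K n) (P β)) * conjMatrix b β σ := by
  rw [combine_apply, map_sum, map_sum]
  refine sum_congr rfl fun β _ => ?_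
  rw [map_mul, map_mul, rename_aeval_elem]
  rfl

/-- A relation `c` among the columns says `∑ c_σ σ(b_β) = 0` for all `β`. Polynomials in `elem` are
invariant and `b` spans over them, so `∑ c_σ σ` vanishes on all of `K[v]`, against Dedekind's
independence of characters. -/
theorem conjMatrix_det_ne_zero (hb : Function.Surjective (combine (elem K n) b)) :
    (conjMatrix b).det ≠ 0 := by
  intro h0
  obtain ⟨c, hc0, hc⟩ := Matrix.exists_mulVec_eq_zero_iff.mpr h0
  apply hc0
  set φ : Equiv.Perm (Fin n) → (MvPolynomial (Fin n) K →* (RatFun K n)) := fun σ =>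
    ((algebraMap (MvPolynomial (Fin n) K) (RatFun K n)).comp (rename (R := K) σ).toRingHom : _ →* (RatFun K n)) with hφ
  have hφinj : Function.Injective φ := by
    intro σ τ h
    ext i
    have := DFunLike.congr_fun h (X i)
    have h' : algebraMap (MvPolynomial (Fin n) K) (RatFun K n) (rename σ (X i)) =
      algebraMap (MvPolynomial (Fin n) K) (RatFun K n) (rename τ (X i)) := this
    have := IsFractionRing.injective (MvPolynomial (Fin n) K) (RatFun K n) h'
    rw [rename_X, rename_X] at this
    exact congrArg Fin.val (X_injective this)
  have hli := (linearIndependent_monoidHom (MvPolynomial (Fin n) K) (RatFun K n)).comp φ hφinj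
  rw [Fintype.linearIndependent_iff] at hli
  funext σ
  refine hli c ?_ σ
  funext h
  obtain ⟨P, rfl⟩ := hb h
  have : ∀ σ, φ σ (combine (elem K n) b P) =
      ∑ β, algebraMap _ (RatFun K n) (aeval (elem K n) (P β)) * conjMatrix b β σ :=
    fun σ => rename_combine b σ P
  simp only [Finset.sum_apply, Pi.smul_apply, smul_eq_mul, Pi.zero_apply, Function.comp_apply, this,
    mul_sum]
  rw [sum_comm]
  refine sum_eq_zero fun β _ => ?_
  have hβ := congrFun hc β
  rw [Matrix.mulVec, dotProduct, Pi.zero_apply] at hβ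
  calc _ = algebraMap _ (RatFun K n) (aeval (elem K n) (P β)) * ∑ σ, conjMatrix b β σ * c σ := by
        rw [mul_sum]
        exact sum_congr rfl fun σ _ => by ring
    _ = 0 := by rw [hβ, mul_zero]

/-- Conjugating a relation `∑ P_β(elem) b_β = 0` by every permutation gives a row vector killed by
the invertible `conjMatrix b`. -/
theorem combine_bijective (hb : Function.Surjective (combine (elem K n) b)) :
    Function.Bijective (combine (elem K n) b) := by
  refine ⟨?_, hb⟩
  rw [injective_iff_map_eq_zero]
  intro P hP
  have h := Matrix.eq_zero_of_vecMul_eq_zero (conjMatrix_det_ne_zero b hb)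
    (v := fun β => algebraMap _ _ (aeval (elem K n) (P β))) (by
      funext σ
      have := rename_combine b σ P
      rw [hP, map_zero, map_zero] at this
      exact this.symm)
  funext β
  have h1 := congrFun h β
  rw [Pi.zero_apply, FaithfulSMul.algebraMap_eq_zero_iff] at h1
  exact aeval_elem_injective K n (by rw [h1, Pi.zero_apply, map_zero])

theorem elem_isWeightedHomogeneous (i : Fin n) :
    IsWeightedHomogeneous (fun _ => (1 : ℤ)) (elem K n i) (n - i) := by
  rw [elem_eq_esymm]
  have hes : (esymm (Fin n) K (n - i)).IsHomogeneous (n - i) := by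
    refine IsHomogeneous.sum _ _ _ fun t ht => ?_
    have := IsHomogeneous.prod (R := K) t (fun i => X i) (fun _ => 1) fun i _ => isHomogeneous_X K i
    rwa [sum_const, smul_eq_mul, mul_one, (mem_powersetCard.mp ht).2] at this
  intro s hs
  have h1 : ((-1) ^ (n - i : ℕ) * esymm (Fin n) K (n - i)) =
      C ((-1) ^ (n - i : ℕ)) * esymm (Fin n) K (n - i) := by simp
  rw [h1, coeff_C_mul] at hs
  have h2 := hes (right_ne_zero_of_mul hs)
  rw [Finsupp.weight_apply, Finsupp.sum] at h2 ⊢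
  simp only [Pi.one_apply, smul_eq_mul, mul_one] at h2
  simp only [nsmul_eq_mul, mul_one]
  rw [← Nat.cast_sum, h2]
  have := i.2
  omega

theorem aeval_elem_isWeightedHomogeneous {m : ℤ} {p : MvPolynomial (Fin n) K}
    (hp : IsWeightedHomogeneous (fun i : Fin n => (n - i : ℤ)) p m) :
    IsWeightedHomogeneous (fun _ => (1 : ℤ)) (aeval (elem K n) p) m := by
  rw [aeval_def, eval₂_eq']
  refine IsWeightedHomogeneous.sum _ _ _ fun s hs => ?_
  have h1 : IsWeightedHomogeneous (fun _ => (1 : ℤ))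
      (∏ i, elem K n i ^ s i) (∑ i, s i • (n - i : ℤ)) :=
    IsWeightedHomogeneous.prod _ _ _ fun i _ => (elem_isWeightedHomogeneous i).pow _
  have h2 : ∑ i, s i • (n - i : ℤ) = m := by
    rw [← hp (mem_support_iff.mp hs), Finsupp.weight_apply, Finsupp.sum_fintype _ _ (by simp)]
  rw [h2] at h1
  have := h1.C_mul (coeff s p)
  rwa [← algebraMap_eq] at this

/-- With weight `n - i` on `X i`, substitution of `elem` preserves the grading. -/
theorem component_aeval_elem_mul {d : ℤ} {q : MvPolynomial (Fin n) K}
    (hq : IsWeightedHomogeneous (fun _ => (1 : ℤ)) q d) (m : ℤ) (p : MvPolynomial (Fin n) K) :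
    weightedHomogeneousComponent (fun _ => (1 : ℤ)) m (aeval (elem K n) p * q) =
      aeval (elem K n)
        (weightedHomogeneousComponent (fun i : Fin n => (n - i : ℤ)) (m - d) p) * q := by
  induction p using MvPolynomial.induction_on' with
  | monomial s c =>
    have h1 := isWeightedHomogeneous_monomial (fun i : Fin n => (n - i : ℤ)) s c rfl
    have h2 := (aeval_elem_isWeightedHomogeneous h1).mul hq
    by_cases h : m = Finsupp.weight (fun i : Fin n => (n - i : ℤ)) s + d
    · rw [h, h2.weightedHomogeneousComponent_same, add_sub_cancel_right,
        h1.weightedHomogeneousComponent_same]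
    · rw [h2.weightedHomogeneousComponent_ne _ h,
        h1.weightedHomogeneousComponent_ne _ (fun h' => h (by omega)), map_zero, zero_mul]
  | add p q hp hq => rw [map_add, add_mul, map_add, hp, hq, map_add, map_add, add_mul]

end Coordinates

open MvPolynomial

/-! ### First order expansion of the substitution of `g` for `elem`. -/

section Perturbation

variable {K : Type*} [Field K] {n : ℕ}

/-- The derivation along `aeval elem` taking `X i` to `G i`. -/
noncomputable def tangent (G : Fin n → MvPolynomial (Fin n) K) :
    MvPolynomial (Fin n) K →ₗ[K] MvPolynomial (Fin n) K :=
  ∑ i, (LinearMap.mulRight K (G i)) ∘ₗ (aeval (R := K) (elem K n)).toLinearMap ∘ₗ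
    (pderiv i).toLinearMap

variable (G : Fin n → MvPolynomial (Fin n) K)

theorem tangent_apply (p : MvPolynomial (Fin n) K) :
    tangent G p = ∑ i, aeval (elem K n) (pderiv i p) * G i := by
  simp [tangent]

theorem tangent_mul (p q : MvPolynomial (Fin n) K) :
    tangent G (p * q) = aeval (elem K n) p * tangent G q + tangent G p * aeval (elem K n) q := by
  simp only [tangent_apply, mul_sum, sum_mul, ← sum_add_distrib]
  refine sum_congr rfl fun i _ => ?_
  rw [Derivation.leibniz, map_add, smul_eq_mul, smul_eq_mul, map_mul, map_mul]
  ring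

theorem tangent_X (i : Fin n) : tangent G (X i) = G i := by
  classical
  rw [tangent_apply, sum_eq_single i]
  · simp
  · intro j _ hj
    rw [pderiv_X_of_ne (Ne.symm hj), map_zero, zero_mul]
  · simp

theorem tangent_C (c : K) : tangent G (C c) = 0 := by
  simp [tangent_apply]

theorem tangent_one : tangent G 1 = 0 := by
  simpa using tangent_C G (1 : K)

variable (g : Fin n → MvPolynomial (Fin n) K) (k : ℤ)

/-- `p(g)` agrees with `p(elem) + tangent G p` up to weight drop more than `k`. -/
structure IsFirstOrder (p : MvPolynomial (Fin n) K) (m : ℤ) : Prop where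
  main : aeval (elem K n) p ∈ weightLE (fun _ => (1 : ℤ)) m
  first : tangent G p ∈ weightLE (fun _ => (1 : ℤ)) (m - k)
  rest : aeval g p - aeval (elem K n) p - tangent G p ∈ weightLE (fun _ => (1 : ℤ)) (m - k - 1)

variable {G g k}

/-- The product of two first order terms drops `2k` in weight; since `1 ≤ k`, this is at least `k +
1` and goes into the remainder. -/
theorem IsFirstOrder.mul (hk : 1 ≤ k) {p q : MvPolynomial (Fin n) K} {m m' : ℤ}
    (hp : IsFirstOrder G g k p m) (hq : IsFirstOrder G g k q m') :
    IsFirstOrder G g k (p * q) (m + m') := by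
  refine ⟨?_, ?_, ?_⟩
  · rw [map_mul]
    exact mul_mem_weightLE hp.main hq.main
  · rw [tangent_mul]
    exact add_mem (weightLE_mono (by omega) (mul_mem_weightLE hp.main hq.first))
      (weightLE_mono (by omega) (mul_mem_weightLE hp.first hq.main))
  · rw [map_mul, map_mul, tangent_mul]
    have h : aeval g p * aeval g q - aeval (elem K n) p * aeval (elem K n) q -
        (aeval (elem K n) p * tangent G q + tangent G p * aeval (elem K n) q) =
        (aeval g p - aeval (elem K n) p - tangent G p) *
          ((aeval g q - aeval (elem K n) q - tangent G q) + aeval (elem K n) q + tangent G q) +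
        aeval (elem K n) p * (aeval g q - aeval (elem K n) q - tangent G q) +
        tangent G p * (aeval g q - aeval (elem K n) q - tangent G q) +
        tangent G p * tangent G q := by ring
    rw [h]
    refine add_mem (add_mem (add_mem ?_ ?_) ?_) ?_
    · refine weightLE_mono (by omega) (mul_mem_weightLE hp.rest (d' := m')
        (add_mem (add_mem ?_ hq.main) ?_))
      · exact weightLE_mono (by omega) hq.rest
      · exact weightLE_mono (by omega) hq.first
    · exact weightLE_mono (by omega) (mul_mem_weightLE hp.main hq.rest)
    · exact weightLE_mono (by omega) (mul_mem_weightLE hp.first hq.rest)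
    · exact weightLE_mono (by omega) (mul_mem_weightLE hp.first hq.first)

theorem IsFirstOrder.one : IsFirstOrder G g k 1 0 := by
  refine ⟨?_, ?_, ?_⟩
  · rw [map_one]
    exact (isWeightedHomogeneous_one K _).mem_weightLE
  · rw [tangent_one]
    exact zero_mem _
  · rw [map_one, map_one, tangent_one, sub_self, sub_zero]
    exact zero_mem _

theorem IsFirstOrder.monomial (hk : 1 ≤ k)
    (hG : ∀ i : Fin n, G i ∈ weightLE (fun _ => (1 : ℤ)) (n - i - k))
    (hg : ∀ i : Fin n, g i - elem K n i - G i ∈ weightLE (fun _ => (1 : ℤ)) (n - i - k - 1))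
    (s : Fin n →₀ ℕ) :
    IsFirstOrder G g k (MvPolynomial.monomial s 1)
      (Finsupp.weight (fun i : Fin n => (n - i : ℤ)) s) := by
  induction s using Finsupp.induction_linear with
  | zero =>
    rw [map_zero]
    exact IsFirstOrder.one
  | add s t hs ht =>
    rw [map_add, show MvPolynomial.monomial (s + t) (1 : K) =
      MvPolynomial.monomial s 1 * MvPolynomial.monomial t 1 by rw [monomial_mul, one_mul]]
    exact hs.mul hk ht
  | single i a =>
    rw [← X_pow_eq_monomial, Finsupp.weight_single]
    induction a with
    | zero => simpa using IsFirstOrder.one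
    | succ a ih =>
      rw [pow_succ, succ_nsmul]
      refine ih.mul hk ⟨?_, ?_, ?_⟩
      · rw [aeval_X]
        exact (elem_isWeightedHomogeneous i).mem_weightLE
      · rw [tangent_X]
        exact hG i
      · rw [aeval_X, aeval_X, tangent_X]
        exact hg i

theorem isFirstOrder_of_mem (hk : 1 ≤ k)
    (hG : ∀ i : Fin n, G i ∈ weightLE (fun _ => (1 : ℤ)) (n - i - k))
    (hg : ∀ i : Fin n, g i - elem K n i - G i ∈ weightLE (fun _ => (1 : ℤ)) (n - i - k - 1))
    {m : ℤ} {p : MvPolynomial (Fin n) K} (hp : p ∈ weightLE (fun i : Fin n => (n - i : ℤ)) m) :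
    IsFirstOrder G g k p m := by
  refine ⟨?_, ?_, ?_⟩
  · exact weightLE_induction hp
      (S := (weightLE (fun _ => (1 : ℤ)) m).comap (aeval (elem K n)).toLinearMap)
      fun s hs => weightLE_mono hs (IsFirstOrder.monomial hk hG hg s).main
  · exact weightLE_induction hp
      (S := (weightLE (fun _ => (1 : ℤ)) (m - k)).comap (tangent G))
      fun s hs => weightLE_mono (by omega) (IsFirstOrder.monomial hk hG hg s).first
  · exact weightLE_induction hp
      (S := (weightLE (fun _ => (1 : ℤ)) (m - k - 1)).comap
        ((aeval g).toLinearMap - (aeval (elem K n)).toLinearMap - tangent G))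
      fun s hs => weightLE_mono (by omega) (IsFirstOrder.monomial hk hG hg s).rest

end Perturbation

/-! ### Compatibility of the coordinates with the grading. -/

section Coordinates

variable {K : Type*} [Field K] {n : ℕ} (b : Equiv.Perm (Fin n) → MvPolynomial (Fin n) K)
  (hsurj : Function.Surjective (combine (elem K n) b))

/-- The coordinates with respect to `b` over the polynomials in `elem`. -/
noncomputable def coordEquiv :
    (Equiv.Perm (Fin n) → MvPolynomial (Fin n) K) ≃ₗ[K] MvPolynomial (Fin n) K :=
  LinearEquiv.ofBijective (combine (elem K n) b) (combine_bijective b hsurj)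

theorem combine_coordEquiv_symm (h : MvPolynomial (Fin n) K) :
    combine (elem K n) b ((coordEquiv b hsurj).symm h) = h :=
  (coordEquiv b hsurj).apply_symm_apply h

variable {d : Equiv.Perm (Fin n) → ℤ}
  (hb : ∀ α, IsWeightedHomogeneous (fun _ => (1 : ℤ)) (b α) (d α))

include hb

theorem component_coord (h : MvPolynomial (Fin n) K) (β : Equiv.Perm (Fin n)) (j : ℤ) :
    weightedHomogeneousComponent (fun i : Fin n => (n - i : ℤ)) j
        ((coordEquiv b hsurj).symm h β) =
      (coordEquiv b hsurj).symm
        (weightedHomogeneousComponent (fun _ => (1 : ℤ)) (j + d β) h) β := by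
  have key : ∀ m : ℤ, weightedHomogeneousComponent (fun _ => (1 : ℤ)) m h =
      coordEquiv b hsurj fun β => weightedHomogeneousComponent (fun i : Fin n => (n - i : ℤ))
        (m - d β) ((coordEquiv b hsurj).symm h β) := by
    intro m
    conv_lhs => rw [← combine_coordEquiv_symm b hsurj h, combine_apply, map_sum]
    change _ = combine (elem K n) b _
    rw [combine_apply]
    exact sum_congr rfl fun β _ => component_aeval_elem_mul (hb β) m _
  rw [key, LinearEquiv.symm_apply_apply, add_sub_cancel_right]

theorem coord_mem_weightLE {m : ℤ} {h : MvPolynomial (Fin n) K}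
    (hh : h ∈ weightLE (fun _ => (1 : ℤ)) m) (β : Equiv.Perm (Fin n)) :
    (coordEquiv b hsurj).symm h β ∈ weightLE (fun i : Fin n => (n - i : ℤ)) (m - d β) := by
  rw [mem_weightLE_iff_component] at hh ⊢
  intro j hj
  rw [component_coord b hsurj hb, hh _ (by omega), map_zero, Pi.zero_apply]

/-- As `b β` has degree `d β`, the constant term of the coordinate at `β` sees only the part of `h`
of degree `d β`. -/
theorem constantCoeff_coord_eq_zero {h : MvPolynomial (Fin n) K} {β : Equiv.Perm (Fin n)}
    (hh : weightedHomogeneousComponent (fun _ => (1 : ℤ)) (d β) h = 0) :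
    constantCoeff ((coordEquiv b hsurj).symm h β) = 0 := by
  classical
  have h1 := component_coord b hsurj hb h β 0
  rw [zero_add, hh, map_zero, Pi.zero_apply] at h1
  have h2 := congrArg (coeff 0) h1
  rw [coeff_weightedHomogeneousComponent, map_zero, if_pos rfl, coeff_zero] at h2
  exact h2

end Coordinates

/-! ### The same basis over the deformed coefficients. -/

section Deformation

variable {K : Type*} [Field K] {n : ℕ} (b : Equiv.Perm (Fin n) → MvPolynomial (Fin n) K)
  (hsurj : Function.Surjective (combine (elem K n) b))
  (G g : Fin n → MvPolynomial (Fin n) K) (k : ℤ) {d : Equiv.Perm (Fin n) → ℤ}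

/-- The first order term of the deformation from `elem` to `g`. -/
noncomputable def tangentMap : MvPolynomial (Fin n) K →ₗ[K] MvPolynomial (Fin n) K :=
  ∑ β, (LinearMap.mulRight K (b β)) ∘ₗ tangent G ∘ₗ LinearMap.proj β ∘ₗ
    (coordEquiv b hsurj).symm.toLinearMap

theorem tangentMap_apply (h : MvPolynomial (Fin n) K) :
    tangentMap b hsurj G h = ∑ β, tangent G ((coordEquiv b hsurj).symm h β) * b β := by
  simp [tangentMap]

/-- The linear automorphism replacing `elem` by `g` and fixing `b`. -/
noncomputable def deform : MvPolynomial (Fin n) K →ₗ[K] MvPolynomial (Fin n) K :=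
  combine g b ∘ₗ (coordEquiv b hsurj).symm.toLinearMap

variable (hb : ∀ α, IsWeightedHomogeneous (fun _ => (1 : ℤ)) (b α) (d α)) (hk : 1 ≤ k)
  (hG : ∀ i : Fin n, G i ∈ weightLE (fun _ => (1 : ℤ)) (n - i - k))
  (hg : ∀ i : Fin n, g i - elem K n i - G i ∈ weightLE (fun _ => (1 : ℤ)) (n - i - k - 1))

include hb hk hG hg

theorem tangentMap_mem {m : ℤ} {h : MvPolynomial (Fin n) K}
    (hh : h ∈ weightLE (fun _ => (1 : ℤ)) m) :
    tangentMap b hsurj G h ∈ weightLE (fun _ => (1 : ℤ)) (m - k) := by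
  rw [tangentMap_apply]
  refine sum_mem fun β _ => ?_
  have := (isFirstOrder_of_mem hk hG hg (coord_mem_weightLE b hsurj hb hh β)).first
  exact weightLE_mono (by omega) (mul_mem_weightLE this (hb β).mem_weightLE)

theorem deform_sub_mem {m : ℤ} {h : MvPolynomial (Fin n) K}
    (hh : h ∈ weightLE (fun _ => (1 : ℤ)) m) :
    deform b hsurj g h - h - tangentMap b hsurj G h ∈ weightLE (fun _ => (1 : ℤ)) (m - k - 1) := by
  have h1 : deform b hsurj g h - h - tangentMap b hsurj G h =
      ∑ β, (aeval g ((coordEquiv b hsurj).symm h β) -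
        aeval (elem K n) ((coordEquiv b hsurj).symm h β) -
        tangent G ((coordEquiv b hsurj).symm h β)) * b β := by
    conv_lhs => rw [← combine_coordEquiv_symm b hsurj h]
    rw [tangentMap_apply, deform, LinearMap.comp_apply, combine_coordEquiv_symm]
    simp only [LinearEquiv.coe_coe]
    conv_lhs => enter [1, 2]; rw [← combine_coordEquiv_symm b hsurj h]
    rw [combine_apply, combine_apply, ← sum_sub_distrib, ← sum_sub_distrib]
    exact sum_congr rfl fun β _ => by ring
  rw [h1]
  refine sum_mem fun β _ => ?_
  have := (isFirstOrder_of_mem hk hG hg (coord_mem_weightLE b hsurj hb hh β)).rest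
  exact weightLE_mono (by omega) (mul_mem_weightLE this (hb β).mem_weightLE)

theorem deform_sub_mem_pred (m : ℤ) (h : MvPolynomial (Fin n) K)
    (hh : h ∈ weightLE (fun _ => (1 : ℤ)) m) :
    deform b hsurj g h - h ∈ weightLE (fun _ => (1 : ℤ)) (m - 1) := by
  have h1 := weightLE_mono (by omega) (deform_sub_mem b hsurj G g k hb hk hG hg hh)
    (d' := m - 1)
  have h2 := weightLE_mono (by omega) (tangentMap_mem b hsurj G g k hb hk hG hg hh) (d' := m - 1)
  have := add_mem h1 h2
  rwa [sub_add_cancel] at this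

-- `combine g b` is `deform` after the coordinate isomorphism, and `deform` is the identity up to
-- lower weight.
include hsurj in
theorem combine_deformed_bijective : Function.Bijective (combine g b) := by
  have hθ : Function.Bijective (deform b hsurj g) := by
    refine ⟨injective_of_sub_mem_weightLE (fun _ => zero_le_one) _
      (deform_sub_mem_pred b hsurj G g k hb hk hG hg), fun p => ?_⟩
    obtain ⟨m, hm⟩ := exists_mem_weightLE (w := fun _ : Fin n => (1 : ℤ)) p
    obtain ⟨q, -, hq⟩ := exists_eq_of_sub_mem_weightLE (fun _ => zero_le_one) _
      (deform_sub_mem_pred b hsurj G g k hb hk hG hg) m p hm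
    exact ⟨q, hq⟩
  have : ⇑(combine g b) = deform b hsurj g ∘ coordEquiv b hsurj := by
    funext P
    simp [deform]
  rw [this]
  exact hθ.comp (coordEquiv b hsurj).bijective

/-- The coordinates of a homogeneous polynomial over the polynomials in `g`, `k` degrees below
the top. -/
theorem constantCoeff_deformed_coord {P : Equiv.Perm (Fin n) → MvPolynomial (Fin n) K}
    {α : Equiv.Perm (Fin n)}
    (hP : IsWeightedHomogeneous (fun _ => (1 : ℤ)) (combine g b P) (k + d α)) :
    constantCoeff (P α) = -constantCoeff
      ((coordEquiv b hsurj).symm (tangentMap b hsurj G (combine g b P)) α) := by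
  set h := combine g b P with hh
  set D := tangentMap b hsurj G
  have hhm := hP.mem_weightLE
  have hD := tangentMap_mem b hsurj G g k hb hk hG hg hhm
  have hDD := tangentMap_mem b hsurj G g k hb hk hG hg hD
  -- `h - D h` inverts `deform` to first order; as `h` has degree `k + d α`, the error drops below
  -- degree `d α`.
  have h1 : deform b hsurj g (h - D h) - h ∈ weightLE (fun _ => (1 : ℤ)) (d α - 1) := by
    have e1 := deform_sub_mem b hsurj G g k hb hk hG hg hhm
    have e2 := deform_sub_mem b hsurj G g k hb hk hG hg hD
    have e3 := sub_mem (weightLE_mono (by omega) e1 (d' := d α - 1))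
      (add_mem (weightLE_mono (by omega) e2 (d' := d α - 1))
        (weightLE_mono (by omega) hDD (d' := d α - 1)))
    convert e3 using 1
    rw [map_sub]
    ring
  obtain ⟨q, hq, hqT⟩ := exists_eq_of_sub_mem_weightLE (fun _ => zero_le_one) _
    (deform_sub_mem_pred b hsurj G g k hb hk hG hg) _ _ h1
  have h2 : P = (coordEquiv b hsurj).symm (h - D h - q) := by
    apply (combine_deformed_bijective b hsurj G g k hb hk hG hg).1
    have : deform b hsurj g (h - D h - q) = h := by
      rw [map_sub _ (h - D h), hqT, sub_sub_cancel]
    exact hh.symm.trans this.symm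
  -- Neither `h`, homogeneous of degree `k + d α`, nor `q`, of degree below `d α`, has a component
  -- of degree `d α`; only `D h` contributes.
  have h3 : constantCoeff ((coordEquiv b hsurj).symm h α) = 0 :=
    constantCoeff_coord_eq_zero b hsurj hb (hP.weightedHomogeneousComponent_ne _ (by omega))
  have h4 : constantCoeff ((coordEquiv b hsurj).symm q α) = 0 :=
    constantCoeff_coord_eq_zero b hsurj hb (mem_weightLE_iff_component.mp hq _ (by omega))
  conv_lhs => rw [h2]
  rw [map_sub, map_sub, Pi.sub_apply, Pi.sub_apply, map_sub, map_sub, h3, h4]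
  ring

end Deformation

open MvPolynomial

/-! ### Two computations of the trace of multiplication by `f`. -/

section Trace

variable {K : Type*} [Field K] {n : ℕ} (b : Equiv.Perm (Fin n) → MvPolynomial (Fin n) K)
  (hsurj : Function.Surjective (combine (elem K n) b))

theorem derivation_aeval_elem (G : Fin n → MvPolynomial (Fin n) K)
    (D : Derivation K (MvPolynomial (Fin n) K) (RatFun K n))
    (hD : ∀ i, D (elem K n i) = algebraMap _ _ (G i)) (p : MvPolynomial (Fin n) K) :
    D (aeval (elem K n) p) = algebraMap _ _ (tangent G p) := by
  induction p using MvPolynomial.induction_on with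
  | C c =>
    rw [tangent_C, map_zero, aeval_C]
    exact D.map_algebraMap c
  | add p q hp hq => rw [map_add, map_add, map_add, map_add, hp, hq]
  | mul_X p i hp =>
    rw [map_mul, aeval_X, Derivation.leibniz, hD, hp, tangent_mul, tangent_X, aeval_X, map_add,
      map_mul, map_mul, Algebra.smul_def, Algebra.smul_def]
    ring

/-- The trace of the first order term of the deformation, composed with multiplication by `f`. -/
theorem sum_coord_tangentMap (G : Fin n → MvPolynomial (Fin n) K)
    (D : Derivation K (MvPolynomial (Fin n) K) (RatFun K n))
    (hD : ∀ i, D (elem K n i) = algebraMap _ _ (G i)) (f : MvPolynomial (Fin n) K) :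
    algebraMap _ (RatFun K n) (aeval (elem K n)
      (∑ α, (coordEquiv b hsurj).symm (tangentMap b hsurj G (f * b α)) α)) =
      ∑ σ, permFrac K n σ (D f) := by
  set E := coordEquiv b hsurj with hE
  set B := conjMatrix b with hB
  set F : Matrix (Equiv.Perm (Fin n)) (Equiv.Perm (Fin n)) (RatFun K n) :=
    Matrix.diagonal fun σ => algebraMap _ _ (rename σ f) with hF
  set F' : Matrix (Equiv.Perm (Fin n)) (Equiv.Perm (Fin n)) (RatFun K n) :=
    Matrix.diagonal fun σ => permFrac K n σ (D f) with hF'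
  set B' : Matrix (Equiv.Perm (Fin n)) (Equiv.Perm (Fin n)) (RatFun K n) :=
    Matrix.of fun α σ => permFrac K n σ (D (b α)) with hB'
  set M : Matrix (Equiv.Perm (Fin n)) (Equiv.Perm (Fin n)) (RatFun K n) :=
    Matrix.of fun α β => algebraMap _ _ (aeval (elem K n) (E.symm (f * b α) β)) with hM
  set Y : Matrix (Equiv.Perm (Fin n)) (Equiv.Perm (Fin n)) (RatFun K n) :=
    Matrix.of fun α β => algebraMap _ _
      (aeval (elem K n) (E.symm (tangentMap b hsurj G (f * b α)) β)) with hY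
  -- `M` represents multiplication by `f` in the basis `b`; the matrix of conjugates diagonalizes
  -- it.
  have hMB : M * B = B * F := by
    ext α σ
    rw [Matrix.mul_apply, Matrix.mul_diagonal]
    simp only [hM, Matrix.of_apply]
    rw [← rename_combine, combine_coordEquiv_symm, map_mul, map_mul, mul_comm]
    rfl
  -- Apply `D` to `f b_α = ∑ M_{αβ} b_β` and conjugate; the derivatives of the coordinates are the
  -- terms collected in `tangentMap`.
  have hYB : Y * B = B * F' + B' * F - M * B' := by
    ext α σ
    rw [Matrix.sub_apply, Matrix.add_apply, Matrix.mul_diagonal, Matrix.mul_diagonal,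
      Matrix.mul_apply, Matrix.mul_apply]
    simp only [hM, hY, hB', Matrix.of_apply]
    rw [← rename_combine, combine_coordEquiv_symm, tangentMap_apply]
    have h1 : D (f * b α) = ∑ β, (algebraMap _ (RatFun K n)
        (aeval (elem K n) (E.symm (f * b α) β)) * D (b β) + algebraMap _ _ (b β) *
          algebraMap _ _ (tangent G (E.symm (f * b α) β))) := by
      conv_lhs => rw [← combine_coordEquiv_symm b hsurj (f * b α), combine_apply, map_sum]
      refine sum_congr rfl fun β _ => ?_
      rw [Derivation.leibniz, derivation_aeval_elem G D hD, Algebra.smul_def, Algebra.smul_def]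
    rw [Derivation.leibniz, Algebra.smul_def, Algebra.smul_def, sum_add_distrib] at h1
    have h2 := congrArg (permFrac K n σ) h1
    simp only [map_add, map_mul, map_sum, permFrac_algebraMap, rename_aeval_elem] at h2 ⊢
    have h3 : B α σ = algebraMap _ _ (rename σ (b α)) := rfl
    rw [h3, eq_sub_iff_add_eq', mul_comm (permFrac K n σ (D (b α))), add_comm (_ * _ : RatFun K n),
      h2]
    congr 1
    exact sum_congr rfl fun β _ => mul_comm _ _
  have hdet : IsUnit B.det := (conjMatrix_det_ne_zero b hsurj).isUnit
  have hY' : Y = B * F' * B⁻¹ + B' * F * B⁻¹ - M * B' * B⁻¹ := by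
    rw [← Matrix.add_mul, ← Matrix.sub_mul, ← hYB, Matrix.mul_nonsing_inv_cancel_right _ _ hdet]
  have hFB : F * B⁻¹ = B⁻¹ * M := by
    have : B⁻¹ * (M * B) * B⁻¹ = B⁻¹ * (B * F) * B⁻¹ := by rw [hMB]
    rw [Matrix.nonsing_inv_mul_cancel_left _ _ hdet] at this
    rw [← this, Matrix.mul_assoc, Matrix.mul_nonsing_inv_cancel_right _ _ hdet]
  -- Since `F * B⁻¹ = B⁻¹ * M`, the two terms containing `B'` have equal trace by cyclicity and
  -- cancel.
  have htr : Y.trace = F'.trace := by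
    rw [hY', Matrix.trace_sub, Matrix.trace_add, Matrix.trace_mul_comm (B * F'),
      Matrix.nonsing_inv_mul_cancel_left _ _ hdet, Matrix.mul_assoc B' F, hFB,
      Matrix.mul_assoc M, Matrix.trace_mul_comm M, Matrix.mul_assoc B']
    ring
  rw [map_sum, map_sum]
  rw [hF', Matrix.trace_diagonal] at htr
  rw [← htr]
  rfl

variable (g : Fin n → MvPolynomial (Fin n) K)

theorem combine_smul (p : MvPolynomial (Fin n) K)
    (P : Equiv.Perm (Fin n) → MvPolynomial (Fin n) K) :
    combine g b (fun β => p * P β) = aeval g p * combine g b P := by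
  rw [combine_apply, combine_apply, mul_sum]
  exact sum_congr rfl fun β _ => by rw [map_mul, mul_assoc]

/-- If `g` has no zeros but the origin, then multiplication by a polynomial `f` vanishing at the
origin has trace zero modulo `g`. -/
theorem exists_coord_trace_eq_zero [IsAlgClosed K] (hbij : Function.Bijective (combine g b))
    (hzero : ∀ a : Fin n → K, (∀ i, eval a (g i) = 0) → a = 0) (f : MvPolynomial (Fin n) K)
    (hf : eval (0 : Fin n → K) f = 0) :
    ∃ P : Equiv.Perm (Fin n) → Equiv.Perm (Fin n) → MvPolynomial (Fin n) K,
      (∀ α, combine g b (P α) = f * b α) ∧ ∑ α, constantCoeff (P α α) = 0 := by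
  set F := LinearEquiv.ofBijective (combine g b) hbij with hF
  have hFs : ∀ h, combine g b (F.symm h) = h := fun h => F.apply_symm_apply h
  set π : MvPolynomial (Fin n) K → Equiv.Perm (Fin n) → K :=
    fun h β => constantCoeff (F.symm h β) with hπ
  have hπadd : ∀ h h', π (h + h') = π h + π h' := fun h h' => by
    funext β
    simp [hπ]
  have hπmul : ∀ p h : MvPolynomial (Fin n) K, π (aeval g p * h) = constantCoeff p • π h := by
    intro p h
    have : F.symm (aeval g p * h) = fun β => p * F.symm h β := by
      rw [LinearEquiv.symm_apply_eq]
      change _ = combine g b _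
      rw [combine_smul, hFs]
    funext β
    change constantCoeff (F.symm (aeval g p * h) β) = constantCoeff p * constantCoeff (F.symm h β)
    rw [this, map_mul]
  have hπzero : π 0 = 0 := by
    funext β
    simp [hπ]
  have hπsurj : ∀ u, ∃ h, π h = u := fun u =>
    ⟨F fun β => C (u β), by funext β; simp [hπ]⟩
  have hπsum : ∀ (t : Finset (Equiv.Perm (Fin n))) (h : Equiv.Perm (Fin n) → _),
      π (∑ β ∈ t, h β) = ∑ β ∈ t, π (h β) := by
    intro t h
    induction t using Finset.induction_on with
    | empty => simpa using hπzero
    | insert β t hβ ih => rw [sum_insert hβ, sum_insert hβ, hπadd, ih]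
  -- `π` reads off coordinates modulo `(g)`, so `M` is multiplication by `f` on `K[v]/(g)`.
  set M : Matrix (Equiv.Perm (Fin n)) (Equiv.Perm (Fin n)) K :=
    Matrix.of fun α β => π (f * b β) α with hM
  have hMπ : ∀ h, M.mulVec (π h) = π (f * h) := by
    intro h
    conv_rhs => rw [← hFs h, combine_apply, mul_sum]
    rw [hπsum]
    funext α
    rw [Matrix.mulVec, dotProduct, Finset.sum_apply]
    refine sum_congr rfl fun β _ => ?_
    rw [mul_left_comm, hπmul]
    simp [hM, hπ, mul_comm]
  have hMpow : ∀ m h, (M ^ m).mulVec (π h) = π (f ^ m * h) := by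
    intro m
    induction m with
    | zero => intro h; simp
    | succ m ih =>
      intro h
      rw [pow_succ, ← Matrix.mulVec_mulVec, hMπ, ih, pow_succ, mul_assoc]
  have hker : ∀ x ∈ Ideal.span (Set.range g), ∀ h, π (x * h) = 0 := by
    intro x hx
    induction hx using Submodule.span_induction with
    | mem x hx =>
      obtain ⟨i, rfl⟩ := hx
      intro h
      have := hπmul (X i) h
      rwa [aeval_X, constantCoeff_X, zero_smul] at this
    | zero => intro h; rw [zero_mul, hπzero]
    | add x y _ _ hx hy => intro h; rw [add_mul, hπadd, hx, hy, add_zero]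
    | smul a x _ hx => intro h; rw [smul_eq_mul, mul_comm a, mul_assoc, hx]
  -- Nullstellensatz: `f` vanishes at the only possible zero of `g`, so a power of `f` lies in `(g)`
  -- and `M` is nilpotent.
  have hrad : f ∈ (Ideal.span (Set.range g)).radical := by
    rw [← vanishingIdeal_zeroLocus_eq_radical (K := K), mem_vanishingIdeal_iff]
    intro a ha
    have : a = 0 := by
      apply hzero
      intro i
      have := mem_zeroLocus_iff.mp ha (g i) (Ideal.subset_span ⟨i, rfl⟩)
      rwa [aeval_eq_eval] at this
    rw [this, aeval_eq_eval]
    exact hf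
  obtain ⟨m, hm⟩ := hrad
  have hnil : IsNilpotent M := by
    refine ⟨m, Matrix.ext_of_mulVec_single fun β => ?_⟩
    obtain ⟨h, hh⟩ := hπsurj (Pi.single β 1)
    rw [← hh, hMpow, hker _ hm, Matrix.zero_mulVec]
  have htr := (Matrix.isNilpotent_trace_of_isNilpotent hnil).eq_zero
  exact ⟨fun α => F.symm (f * b α), fun α => hFs _, htr⟩

end Trace

/-- If `g = elem + G + (lower terms)` has no zeros but the origin and `D` is the vector field along
which `elem` varies as `G`, then the sum of the conjugates of `D f` vanishes. -/
theorem eq_zero_of_sum_permFrac_derivation {K : Type*} [Field K] [IsAlgClosed K] {n : ℕ}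
    {k : ℤ} (hk : 1 ≤ k) {G g : Fin n → MvPolynomial (Fin n) K}
    (hG : ∀ i : Fin n, G i ∈ weightLE (fun _ => (1 : ℤ)) (n - i - k))
    (hg : ∀ i : Fin n, g i - elem K n i - G i ∈ weightLE (fun _ => (1 : ℤ)) (n - i - k - 1))
    (hzero : ∀ a : Fin n → K, (∀ i, eval a (g i) = 0) → a = 0)
    {f : MvPolynomial (Fin n) K} (hf : IsWeightedHomogeneous (fun _ => (1 : ℤ)) f k)
    (D : Derivation K (MvPolynomial (Fin n) K) (RatFun K n))
    (hD : ∀ i, D (elem K n i) = algebraMap _ _ (G i)) {c : K}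
    (hc : ∑ σ, permFrac K n σ (D f) = algebraMap _ _ (C c : MvPolynomial (Fin n) K)) : c = 0 := by
  obtain ⟨b, d, hb, hspan⟩ := exists_spanning_family K n
  have hsurj : Function.Surjective (combine (elem K n) b) := fun h => by
    obtain ⟨P, hP⟩ := hspan h
    exact ⟨P, by rw [combine_apply, hP]⟩
  have hf0 : eval (0 : Fin n → K) f = 0 := by
    have : constantCoeff f = 0 := by
      rw [constantCoeff_eq]
      refine hf.coeff_eq_zero 0 ?_
      rw [map_zero]
      omega
    simpa using this
  obtain ⟨P, hP, htr⟩ := exists_coord_trace_eq_zero b g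
    (combine_deformed_bijective b hsurj G g k hb hk hG hg) hzero f hf0
  have h1 := sum_coord_tangentMap b hsurj G D hD f
  rw [hc] at h1
  have h2 := IsFractionRing.injective (MvPolynomial (Fin n) K) (RatFun K n) h1
  rw [← algebraMap_eq, ← AlgHom.commutes (aeval (elem K n))] at h2
  have h3 := congrArg constantCoeff (aeval_elem_injective K n h2)
  rw [algebraMap_eq, constantCoeff_C, map_sum] at h3
  rw [← h3, ← neg_eq_zero, ← sum_neg_distrib, ← htr]
  refine sum_congr rfl fun α _ => ?_
  rw [← hP α]
  refine (constantCoeff_deformed_coord b hsurj G g k hb hk hG hg ?_).symm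
  rw [hP α]
  exact hf.mul (hb α)

/-! ### Two identities from Lagrange interpolation. -/

section Lagrange

variable {F ι : Type*} [Field F] [DecidableEq ι]

theorem lagrange_basis_eq (s : Finset ι) (v : ι → F) (j : ι) :
    Lagrange.basis s v j = Polynomial.C (∏ l ∈ s.erase j, (v j - v l))⁻¹ *
      ∏ l ∈ s.erase j, (Polynomial.X - Polynomial.C (v l)) := by
  rw [Lagrange.basis, ← prod_inv_distrib, map_prod, ← prod_mul_distrib]
  rfl

/-- The Lagrange basis polynomials sum to `1`; evaluate at `0`. -/
theorem sum_prod_div_prod_sub (s : Finset ι) (hs : s.Nonempty) (v : ι → F)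
    (hv : Set.InjOn v s) :
    ∑ j ∈ s, (∏ l ∈ s.erase j, v l) / ∏ l ∈ s.erase j, (v j - v l) = (-1) ^ (#s - 1) := by
  have h := congrArg (Polynomial.eval 0) (Lagrange.sum_basis hv hs)
  rw [Polynomial.eval_finsetSum, Polynomial.eval_one] at h
  calc _ = (-1) ^ (#s - 1) * ∑ j ∈ s, (Lagrange.basis s v j).eval 0 := by
        rw [mul_sum]
        refine sum_congr rfl fun j hj => ?_
        rw [lagrange_basis_eq, Polynomial.eval_mul, Polynomial.eval_C, Polynomial.eval_prod,
          ← card_erase_of_mem hj]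
        simp only [Polynomial.eval_sub, Polynomial.eval_X, Polynomial.eval_C, zero_sub]
        rw [prod_neg, div_eq_inv_mul]
        have : ((-1 : F) ^ #(s.erase j)) * (-1) ^ #(s.erase j) = 1 := by
          rw [← mul_pow]; simp
        linear_combination (-(∏ l ∈ s.erase j, (v j - v l))⁻¹ * ∏ l ∈ s.erase j, v l) * this
    _ = _ := by rw [h, mul_one]

/-- Compare coefficients of `X ^ (#s - 1 - q)`, a positive power, in the same identity. The nodes
are `-v l` so that elementary symmetric sums appear without signs. -/
theorem sum_esymm_div_prod_sub (s : Finset ι) (v : ι → F) (hv : Set.InjOn v s) {q : ℕ}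
    (hq : q + 1 < #s) :
    ∑ j ∈ s, (∑ Q ∈ (s.erase j).powersetCard q, ∏ l ∈ Q, v l) /
      ∏ l ∈ s.erase j, (v j - v l) = 0 := by
  have hs : s.Nonempty := card_pos.mp (by omega)
  have hv' : Set.InjOn (fun l => -v l) s := fun a ha b hb h => hv ha hb (neg_injective h)
  have h := congrArg (fun p => Polynomial.coeff p (#s - 1 - q)) (Lagrange.sum_basis hv' hs)
  simp only [Polynomial.finsetSum_coeff] at h
  rw [Polynomial.coeff_one, if_neg (by omega)] at h
  calc _ = (-1) ^ (#s - 1) *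
        ∑ j ∈ s, (Lagrange.basis s (fun l => -v l) j).coeff (#s - 1 - q) := by
        rw [mul_sum]
        refine sum_congr rfl fun j hj => ?_
        rw [lagrange_basis_eq, Polynomial.coeff_C_mul]
        simp only [Polynomial.C_neg, sub_neg_eq_add]
        rw [Finset.prod_X_add_C_coeff _ _ (by rw [card_erase_of_mem hj]; omega),
          card_erase_of_mem hj, show #s - 1 - (#s - 1 - q) = q by omega, ← card_erase_of_mem hj,
          show ∏ l ∈ s.erase j, (-v j + v l) = (-1) ^ #(s.erase j) * ∏ l ∈ s.erase j, (v j - v l) by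
            rw [← prod_neg]; exact prod_congr rfl fun _ _ => by ring]
        have h1 : ((-1 : F) ^ #(s.erase j)) * ((-1) ^ #(s.erase j))⁻¹ = 1 :=
          mul_inv_cancel₀ (pow_ne_zero _ (by simp))
        rw [mul_inv, ← mul_assoc, ← mul_assoc, h1, one_mul, div_eq_inv_mul]
    _ = 0 := by rw [h, mul_zero]

end Lagrange

/-! ### Permutations matching configurations of subsets. -/

section Transitivity

theorem exists_perm_comp_eq {α γ : Type*} [Fintype α] [DecidableEq α] [DecidableEq γ] (c c' : α → γ)
    (h : ∀ x, #{a | c a = x} = #{a | c' a = x}) : ∃ τ : Equiv.Perm α, ∀ a, c' (τ a) = c a := by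
  have e : ∀ x, Nonempty ({a // c a = x} ≃ {a // c' a = x}) := fun x => by
    rw [← Fintype.card_eq, Fintype.card_subtype, Fintype.card_subtype]
    exact h x
  exact ⟨Equiv.ofFiberEquiv fun x => (e x).some, fun a => Equiv.ofFiberEquiv_map _ a⟩

/-- Permutations act transitively on pointed subsets of a given size inside a fixed set `N`, even
if they have to preserve a set `U` disjoint from `N`. -/
theorem exists_perm_map_eq {α : Type*} [Fintype α] [DecidableEq α] {N U Q Q' : Finset α} {j j' : α}
    (hU : Disjoint N U) (hj : j ∈ N) (hj' : j' ∈ N) (hQ : Q ⊆ N.erase j) (hQ' : Q' ⊆ N.erase j')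
    (hcard : #Q = #Q') :
    ∃ τ : Equiv.Perm α, τ j = j' ∧ Q.map τ.toEmbedding = Q' ∧ N.map τ.toEmbedding = N ∧
      U.map τ.toEmbedding = U := by
  -- Colour the point `j`, then `Q`, the rest of `N`, `U`, and everything else. Both configurations
  -- have colour classes of equal sizes, so some permutation matches the colours.
  set c : α → Finset α → α → ℕ := fun j Q a =>
    if a = j then 0 else if a ∈ Q then 1 else if a ∈ N then 2 else if a ∈ U then 3 else 4 with hc
  have hU' : ∀ a, a ∈ N → a ∉ U := fun a ha => disjoint_left.mp hU ha
  have hc0 : ∀ j Q a, c j Q a = 0 ↔ a = j := by intro j Q a; simp only [hc]; grind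
  have hc1 : ∀ j Q a, Q ⊆ N.erase j → (c j Q a = 1 ↔ a ∈ Q) := by
    intro j Q a h; simp only [hc]; grind
  have hc2 : ∀ j Q a, Q ⊆ N.erase j → (c j Q a = 2 ↔ a ∈ N.erase j \ Q) := by
    intro j Q a h; simp only [hc]; grind
  have hc3 : ∀ j Q a, j ∈ N → Q ⊆ N.erase j → (c j Q a = 3 ↔ a ∈ U) := by
    intro j Q a h h'; simp only [hc]; grind
  have hc4 : ∀ j Q a, j ∈ N → Q ⊆ N.erase j → (c j Q a = 4 ↔ a ∉ N ∧ a ∉ U) := by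
    intro j Q a h h'; simp only [hc]; grind
  have hc5 : ∀ j Q a, c j Q a < 5 := by intro j Q a; simp only [hc]; grind
  have hc6 : ∀ j Q a, j ∈ N → Q ⊆ N.erase j → (a ∈ N ↔ c j Q a < 3) := by
    intro j Q a h h'
    have hQN : a ∈ Q → a ∈ N := fun ha => mem_of_mem_erase (h' ha)
    simp only [hc]
    clear_value c
    split_ifs <;> simp_all
  obtain ⟨τ, hτ⟩ := exists_perm_comp_eq (c j Q) (c j' Q') (by
    intro x
    by_cases hx : x < 5
    · interval_cases x
      · simp [hc0, filter_eq']
      · simp [hc1, hQ, hQ', hcard]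
      · simp only [hc2 _ _ _ hQ, hc2 _ _ _ hQ', filter_univ_mem]
        rw [card_sdiff_of_subset hQ, card_sdiff_of_subset hQ', card_erase_of_mem hj,
          card_erase_of_mem hj', hcard]
      · simp only [hc3 _ _ _ hj hQ, hc3 _ _ _ hj' hQ']
      · simp only [hc4 _ _ _ hj hQ, hc4 _ _ _ hj' hQ']
    · rw [filter_false_of_mem, filter_false_of_mem]
      · intro a _ h
        exact hx (h ▸ hc5 _ _ _)
      · intro a _ h
        exact hx (h ▸ hc5 _ _ _))
  have hmap : ∀ S S' : Finset α, (∀ a, τ a ∈ S' ↔ a ∈ S) → S.map τ.toEmbedding = S' := by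
    intro S S' h
    ext a
    rw [mem_map_equiv, ← h, Equiv.apply_symm_apply]
  refine ⟨τ, ?_, ?_, ?_, ?_⟩
  · rw [← hc0 j' Q', hτ, hc0]
  · refine hmap _ _ fun a => ?_
    rw [← hc1 j' Q' _ hQ', hτ, hc1 j Q _ hQ]
  · refine hmap _ _ fun a => ?_
    rw [hc6 j' Q' _ hj' hQ', hτ, hc6 j Q _ hj hQ]
  · refine hmap _ _ fun a => ?_
    rw [← hc3 j' Q' _ hj' hQ', hτ, hc3 j Q _ hj hQ]

end Transitivity

/-! ### Averaging the interpolation quotients over all permutations. -/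

section Symmetrization

open Nat

variable {F : Type*} [Field F] {n : ℕ} (x : Fin n → F)

/-- The conjugate by `σ` of the quotient `∏_{l ∈ Q} x_l / ∏_{l ∈ N, l ≠ j} (x_j - x_l)`. -/
def quotientTerm (σ : Equiv.Perm (Fin n)) (j : Fin n) (Q N : Finset (Fin n)) : F :=
  (∏ l ∈ Q, x (σ l)) / ∏ l ∈ N.erase j, (x (σ j) - x (σ l))

theorem quotientTerm_map (σ τ : Equiv.Perm (Fin n)) (j : Fin n) (Q N : Finset (Fin n)) :
    quotientTerm x σ (τ j) (Q.map τ.toEmbedding) (N.map τ.toEmbedding) =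
      quotientTerm x (σ * τ) j Q N := by
  have h : (N.map τ.toEmbedding).erase (τ j) = (N.erase j).map τ.toEmbedding := by
    rw [map_erase]
    rfl
  rw [quotientTerm, quotientTerm, h, prod_map, prod_map]
  rfl

theorem sum_quotientTerm_map (τ : Equiv.Perm (Fin n)) (j : Fin n) (Q N : Finset (Fin n)) :
    ∑ σ, quotientTerm x σ (τ j) (Q.map τ.toEmbedding) (N.map τ.toEmbedding) =
      ∑ σ, quotientTerm x σ j Q N := by
  simp only [quotientTerm_map]
  exact Equiv.sum_comp (Equiv.mulRight τ) fun σ => quotientTerm x σ j Q N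

variable {x} (hx : Function.Injective x)

include hx

theorem sum_quotientTerm_self {N : Finset (Fin n)} (hN : N.Nonempty) :
    ∑ j ∈ N, ∑ σ, quotientTerm x σ j (N.erase j) N = (n ! : F) * (-1) ^ (#N - 1) := by
  rw [sum_comm]
  have h : ∀ σ : Equiv.Perm (Fin n),
      ∑ j ∈ N, quotientTerm x σ j (N.erase j) N = (-1) ^ (#N - 1) := fun σ =>
    sum_prod_div_prod_sub N hN (fun l => x (σ l)) (hx.comp σ.injective).injOn
  simp only [h]
  rw [sum_const, Finset.card_univ, Fintype.card_perm, Fintype.card_fin, nsmul_eq_mul]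

/-- Write `M` without `j` as `Q ∪ U` with `Q ⊆ N` and `U` disjoint from `N`. After averaging, a term
is unchanged when `(j, Q)` is replaced by any `(j', Q')` in `N` with `#Q' = #Q`. All these terms
together sum to zero by `sum_esymm_div_prod_sub`, so each vanishes once their number is invertible.
-/
theorem sum_quotientTerm_of_ne (hn : (n ! : F) ≠ 0) {M N : Finset (Fin n)} (hMN : #M = #N)
    (hne : N ≠ M) : ∑ j ∈ M ∩ N, ∑ σ, quotientTerm x σ j (M.erase j) N = 0 := by
  refine sum_eq_zero fun j hj => ?_
  rw [mem_inter] at hj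
  obtain ⟨hjM, hjN⟩ := hj
  set U := M \ N with hU
  have hNU : Disjoint N U := disjoint_sdiff
  set Q := (M ∩ N).erase j with hQ
  have hQN : Q ⊆ N.erase j := erase_subset_erase _ inter_subset_right
  have hMU : M.erase j = Q ∪ U := by
    ext a
    simp only [hQ, hU, mem_erase, mem_union, mem_inter, mem_sdiff]
    grind
  -- Distinct sets of equal size meet in a proper subset of `N`; this strictness is what the
  -- interpolation identity needs.
  have hQcard : #Q + 1 < #N := by
    have h1 : #Q + 1 = #(M ∩ N) := card_erase_add_one (mem_inter.mpr ⟨hjM, hjN⟩)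
    rw [h1]
    refine card_lt_card (inter_subset_right.ssubset_of_ne fun h => hne ?_)
    exact eq_of_subset_of_card_le (inter_eq_right.mp h) hMN.le
  have hconst : ∀ j' ∈ N, ∀ Q' ∈ (N.erase j').powersetCard #Q,
      ∑ σ, quotientTerm x σ j' (Q' ∪ U) N = ∑ σ, quotientTerm x σ j (Q ∪ U) N := by
    intro j' hj' Q' hQ'
    rw [mem_powersetCard] at hQ'
    obtain ⟨τ, h1, h2, h3, h4⟩ := exists_perm_map_eq hNU hjN hj' hQN hQ'.1 hQ'.2.symm
    rw [← sum_quotientTerm_map x τ j, map_union, h1, h2, h3, h4]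
  have hzero : ∑ j' ∈ N, ∑ Q' ∈ (N.erase j').powersetCard #Q,
      ∑ σ, quotientTerm x σ j' (Q' ∪ U) N = 0 := by
    have h1 : ∀ σ : Equiv.Perm (Fin n), ∑ j' ∈ N, ∑ Q' ∈ (N.erase j').powersetCard #Q,
        quotientTerm x σ j' (Q' ∪ U) N = 0 := by
      intro σ
      have h2 := sum_esymm_div_prod_sub N (fun l => x (σ l)) (hx.comp σ.injective).injOn hQcard
      calc _ = (∏ l ∈ U, x (σ l)) * ∑ j' ∈ N, (∑ Q' ∈ (N.erase j').powersetCard #Q,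
            ∏ l ∈ Q', x (σ l)) / ∏ l ∈ N.erase j', (x (σ j') - x (σ l)) := by
            rw [mul_sum]
            refine sum_congr rfl fun j' hj' => ?_
            rw [sum_div, mul_sum]
            refine sum_congr rfl fun Q' hQ' => ?_
            have hd : Disjoint Q' U := disjoint_of_subset_left
              ((mem_powersetCard.mp hQ').1.trans (erase_subset _ _)) hNU
            rw [quotientTerm, prod_union hd]
            ring
        _ = 0 := by rw [h2, mul_zero]
    calc _ = ∑ σ : Equiv.Perm (Fin n), ∑ j' ∈ N, ∑ Q' ∈ (N.erase j').powersetCard #Q,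
          quotientTerm x σ j' (Q' ∪ U) N := by
          rw [sum_comm]
          exact sum_congr rfl fun j' _ => sum_comm
      _ = 0 := sum_eq_zero fun σ _ => h1 σ
  have hsum : ∑ j' ∈ N, ∑ Q' ∈ (N.erase j').powersetCard #Q,
      ∑ σ, quotientTerm x σ j' (Q' ∪ U) N =
      ((#N * (#N - 1).choose #Q : ℕ) : F) * ∑ σ, quotientTerm x σ j (Q ∪ U) N := by
    calc _ = ∑ j' ∈ N, ∑ Q' ∈ (N.erase j').powersetCard #Q,
          ∑ σ, quotientTerm x σ j (Q ∪ U) N :=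
          sum_congr rfl fun j' hj' => sum_congr rfl fun Q' hQ' => hconst j' hj' Q' hQ'
      _ = ∑ j' ∈ N, ((#N - 1).choose #Q : F) * ∑ σ, quotientTerm x σ j (Q ∪ U) N := by
          refine sum_congr rfl fun j' hj' => ?_
          rw [sum_const, card_powersetCard, card_erase_of_mem hj', nsmul_eq_mul]
      _ = _ := by
          rw [sum_const, nsmul_eq_mul]
          push_cast
          ring
  -- The number of pairs `(j', Q')` divides `n!`, hence is nonzero in `F`.
  have hdvd : #N * (#N - 1).choose #Q ∣ n ! := by
    have h1 : (#N - 1).choose #Q ∣ (#N - 1)! := by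
      rw [← Nat.choose_mul_factorial_mul_factorial (show #Q ≤ #N - 1 by omega), mul_assoc]
      exact dvd_mul_right _ _
    refine (mul_dvd_mul_left #N h1).trans ?_
    rw [Nat.mul_factorial_pred (by omega)]
    refine Nat.factorial_dvd_factorial ?_
    simpa using card_le_univ N
  have hne0 : ((#N * (#N - 1).choose #Q : ℕ) : F) ≠ 0 := by
    intro h0
    obtain ⟨m, hm⟩ := hdvd
    apply hn
    rw [hm, Nat.cast_mul, h0, zero_mul]
  rw [hzero] at hsum
  rw [hMU]
  exact (mul_eq_zero.mp hsum.symm).resolve_left hne0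

end Symmetrization

open MvPolynomial

/-- The product of the factors `X - x_l` with `l ∉ N`. -/
noncomputable def complPoly {A : Type*} [CommRing A] {n : ℕ} (x : Fin n → A)
    (N : Finset (Fin n)) : Polynomial A :=
  ∏ l ∈ Nᶜ, (Polynomial.X - Polynomial.C (x l))

theorem complPoly_map {A B : Type*} [CommRing A] [CommRing B] {n : ℕ} (f : A →+* B) (x : Fin n → A)
    (N : Finset (Fin n)) : (complPoly x N).map f = complPoly (fun l => f (x l)) N := by
  simp [complPoly, Polynomial.map_prod]

/-! ### Joint degree bounds in `X` and the variables. -/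

section CoeffWeight

variable {K : Type*} [Field K] {n : ℕ}

/-- The coefficient of degree `i` has weight at most `m - i`, for all `i`. -/
def CoeffWeightLE (m : ℤ) (q : Polynomial (MvPolynomial (Fin n) K)) : Prop :=
  ∀ i : ℕ, q.coeff i ∈ weightLE (fun _ => (1 : ℤ)) (m - i)

theorem CoeffWeightLE.mono {m m' : ℤ} (h : m ≤ m') {q : Polynomial (MvPolynomial (Fin n) K)}
    (hq : CoeffWeightLE m q) : CoeffWeightLE m' q :=
  fun i => weightLE_mono (by omega) (hq i)

theorem CoeffWeightLE.add {m : ℤ} {p q : Polynomial (MvPolynomial (Fin n) K)}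
    (hp : CoeffWeightLE m p) (hq : CoeffWeightLE m q) : CoeffWeightLE m (p + q) := fun i => by
  rw [Polynomial.coeff_add]
  exact add_mem (hp i) (hq i)

theorem CoeffWeightLE.sub {m : ℤ} {p q : Polynomial (MvPolynomial (Fin n) K)}
    (hp : CoeffWeightLE m p) (hq : CoeffWeightLE m q) : CoeffWeightLE m (p - q) := fun i => by
  rw [Polynomial.coeff_sub]
  exact sub_mem (hp i) (hq i)

theorem CoeffWeightLE.zero {m : ℤ} :
    CoeffWeightLE m (0 : Polynomial (MvPolynomial (Fin n) K)) := fun i => by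
  rw [Polynomial.coeff_zero]
  exact zero_mem _

theorem CoeffWeightLE.sum {ι : Type*} {m : ℤ} (s : Finset ι)
    {q : ι → Polynomial (MvPolynomial (Fin n) K)} (hq : ∀ i ∈ s, CoeffWeightLE m (q i)) :
    CoeffWeightLE m (∑ i ∈ s, q i) := fun i => by
  rw [Polynomial.finsetSum_coeff]
  exact sum_mem fun j hj => hq j hj i

theorem CoeffWeightLE.mul {m m' : ℤ} {p q : Polynomial (MvPolynomial (Fin n) K)}
    (hp : CoeffWeightLE m p) (hq : CoeffWeightLE m' q) : CoeffWeightLE (m + m') (p * q) :=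
  fun i => by
  rw [Polynomial.coeff_mul]
  refine sum_mem fun a ha => ?_
  have ha' := mem_antidiagonal.mp ha
  exact weightLE_mono (by omega) (mul_mem_weightLE (hp a.1) (hq a.2))

theorem CoeffWeightLE.C_C (c : K) :
    CoeffWeightLE 0 (Polynomial.C (C c) : Polynomial (MvPolynomial (Fin n) K)) := fun i => by
  rw [Polynomial.coeff_C]
  split_ifs with h
  · rw [h]
    exact C_mem_weightLE c
  · exact zero_mem _

theorem CoeffWeightLE.X : CoeffWeightLE 1 (Polynomial.X : Polynomial (MvPolynomial (Fin n) K)) :=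
  fun i => by
  rw [Polynomial.coeff_X]
  split_ifs with h
  · rw [← h]
    exact C_mem_weightLE 1
  · exact zero_mem _

theorem CoeffWeightLE.C_X (l : Fin n) :
    CoeffWeightLE 1 (Polynomial.C (MvPolynomial.X l) : Polynomial (MvPolynomial (Fin n) K)) :=
  fun i => by
  rw [Polynomial.coeff_C]
  split_ifs with h
  · rw [h]
    simpa using (isWeightedHomogeneous_X K (fun _ : Fin n => (1 : ℤ)) l).mem_weightLE
  · exact zero_mem _

theorem CoeffWeightLE.pow {m : ℤ} {p : Polynomial (MvPolynomial (Fin n) K)}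
    (hp : CoeffWeightLE m p) (a : ℕ) : CoeffWeightLE (a * m) (p ^ a) := by
  induction a with
  | zero => simpa using CoeffWeightLE.C_C (1 : K)
  | succ a ih =>
    rw [pow_succ]
    exact (ih.mul hp).mono (by push_cast; linarith)

theorem coeffWeightLE_complPoly (N : Finset (Fin n)) :
    CoeffWeightLE (n - #N) (complPoly (X : Fin n → MvPolynomial (Fin n) K) N) := by
  have h : ∀ s : Finset (Fin n), CoeffWeightLE #s
      (∏ l ∈ s, (Polynomial.X - Polynomial.C (X l : MvPolynomial (Fin n) K))) := by
    intro s
    induction s using Finset.induction_on with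
    | empty => simpa using CoeffWeightLE.C_C (1 : K)
    | insert a s ha ih =>
      rw [prod_insert ha, card_insert_of_notMem ha]
      exact ((CoeffWeightLE.X.sub (CoeffWeightLE.C_X a)).mul ih).mono (by push_cast; linarith)
  refine (h Nᶜ).mono ?_
  rw [card_compl, Fintype.card_fin]
  have := card_le_univ N
  rw [Fintype.card_fin] at this
  omega

end CoeffWeight

/-! ### The vector field of the deviation and its symmetrized value. -/

section VectorField

variable {K : Type*} [Field K] {n : ℕ}

theorem derivation_coeff_prod {A L ι : Type*} [CommRing A] [Algebra K A] [CommRing L] [Algebra K L]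
    [Algebra A L] [DecidableEq ι] (D : Derivation K A L) (x : ι → A) (s : Finset ι) (i : ℕ) :
    D ((∏ l ∈ s, (Polynomial.X - Polynomial.C (x l))).coeff i) =
      (∑ j ∈ s, Polynomial.C (-D (x j)) * ∏ l ∈ s.erase j,
        (Polynomial.X - Polynomial.C (algebraMap A L (x l)))).coeff i := by
  induction s using Finset.induction_on generalizing i with
  | empty =>
    rw [prod_empty, sum_empty, Polynomial.coeff_zero, Polynomial.coeff_one]
    split_ifs <;> simp
  | insert a s ha ih =>
    set P := ∏ l ∈ s, (Polynomial.X - Polynomial.C (x l)) with hP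
    set S := ∑ j ∈ s, Polynomial.C (-D (x j)) * ∏ l ∈ s.erase j,
        (Polynomial.X - Polynomial.C (algebraMap A L (x l))) with hS
    have hPmap : ∏ l ∈ s, (Polynomial.X - Polynomial.C (algebraMap A L (x l))) =
        P.map (algebraMap _ _) := by
      simp [hP, Polynomial.map_prod]
    have hS' : ∑ j ∈ insert a s, Polynomial.C (-D (x j)) * ∏ l ∈ (insert a s).erase j,
        (Polynomial.X - Polynomial.C (algebraMap A L (x l))) =
        Polynomial.C (-D (x a)) * P.map (algebraMap _ _) +
          (Polynomial.X - Polynomial.C (algebraMap A L (x a))) * S := by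
      rw [sum_insert ha, erase_insert ha, hPmap, hS, mul_sum]
      congr 1
      refine sum_congr rfl fun j hj => ?_
      have hja : a ≠ j := fun h => ha (h ▸ hj)
      rw [erase_insert_of_ne hja, prod_insert (fun h => ha (mem_of_mem_erase h))]
      ring
    rw [prod_insert ha, ← hP, hS', sub_mul, sub_mul]
    simp only [Polynomial.coeff_add, Polynomial.coeff_sub, Polynomial.coeff_C_mul, map_sub,
      Polynomial.coeff_map, Derivation.leibniz, ih, Algebra.smul_def]
    cases i with
    | zero =>
      simp only [Polynomial.coeff_X_mul_zero, map_zero]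
      ring
    | succ i =>
      simp only [Polynomial.coeff_X_mul, ih]
      ring

/-- The first order deviation determined by weights `δ` on the subsets of size `k`. -/
noncomputable def deviation (k : ℕ) (δ : Finset (Fin n) → K) :
    Polynomial (MvPolynomial (Fin n) K) :=
  ∑ N ∈ powersetCard k univ, Polynomial.C (C (δ N)) * complPoly X N

/-- The vector field along which `elem` varies as the coefficients of `deviation k δ`. -/
noncomputable def deviationField (k : ℕ) (δ : Finset (Fin n) → K) :
    Derivation K (MvPolynomial (Fin n) K) (RatFun K n) :=
  mkDerivation K fun j => -∑ N ∈ powersetCard k univ, if j ∈ N then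
    algebraMap _ _ (C (δ N) : MvPolynomial (Fin n) K) *
      (∏ l ∈ N.erase j, (algebraMap (MvPolynomial (Fin n) K) (RatFun K n) (X j) - algebraMap (MvPolynomial (Fin n) K) (RatFun K n) (X l)))⁻¹ else 0

theorem algebraMap_X_injective :
    Function.Injective fun l : Fin n => algebraMap (MvPolynomial (Fin n) K) (RatFun K n) (X l) :=
  fun _ _ h => X_injective (IsFractionRing.injective (MvPolynomial (Fin n) K) (RatFun K n) h)

/-- Differentiating `∏ (X - v_l)` and grouping by `N`, the summand is `δ N` times `complPoly X N`
times the sum of the Lagrange basis polynomials on `N`, which is `1`. -/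
theorem deviationField_elem {k : ℕ} (hk : 1 ≤ k) (δ : Finset (Fin n) → K) (i : Fin n) :
    deviationField k δ (elem K n i) = algebraMap _ _ ((deviation k δ).coeff i) := by
  rw [elem, rootPoly, derivation_coeff_prod, ← Polynomial.coeff_map]
  congr 1
  rw [deviation, Polynomial.map_sum]
  simp only [deviationField, mkDerivation_X, neg_neg, map_sum, sum_mul]
  rw [sum_comm]
  refine sum_congr rfl fun N hN => ?_
  have hNk := (mem_powersetCard.mp hN).2
  have hNne : N.Nonempty := card_pos.mp (by omega)
  rw [Polynomial.map_mul, complPoly_map, Polynomial.map_C]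
  rw [← sum_subset (subset_univ N) (fun j _ hj => by rw [if_neg hj, map_zero, zero_mul])]
  have hL := Lagrange.sum_basis (algebraMap_X_injective (K := K) (n := n)).injOn hNne
  calc _ = ∑ j ∈ N, Polynomial.C (algebraMap _ (RatFun K n) (C (δ N))) *
        complPoly (fun l => algebraMap (MvPolynomial (Fin n) K) (RatFun K n) (X l)) N *
        Lagrange.basis N (fun l => algebraMap (MvPolynomial (Fin n) K) (RatFun K n) (X l)) j := by
        refine sum_congr rfl fun j hj => ?_
        rw [if_pos hj, lagrange_basis_eq, map_mul]
        have hsplit : univ.erase j = N.erase j ∪ Nᶜ := by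
          ext a
          simp only [mem_erase, mem_union, mem_univ, mem_compl]
          grind
        rw [hsplit, prod_union (disjoint_compl_right.mono_left (erase_subset _ _)), complPoly]
        ring
    _ = _ := by rw [← mul_sum, hL, mul_one]

theorem derivation_prod {A L ι : Type*} [CommRing A] [Algebra K A] [CommRing L] [Algebra K L]
    [Algebra A L] [DecidableEq ι] (D : Derivation K A L) (x : ι → A) (M : Finset ι) :
    D (∏ l ∈ M, x l) = ∑ j ∈ M, (∏ l ∈ M.erase j, algebraMap A L (x l)) * D (x j) := by
  induction M using Finset.induction_on with
  | empty => simp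
  | insert a s ha ih =>
    rw [prod_insert ha, Derivation.leibniz, ih, sum_insert ha, erase_insert ha, Algebra.smul_def,
      Algebra.smul_def, mul_sum, map_prod, add_comm]
    congr 1
    refine sum_congr rfl fun j hj => ?_
    have hja : a ≠ j := fun h => ha (h ▸ hj)
    rw [erase_insert_of_ne hja, prod_insert (fun h => ha (mem_of_mem_erase h))]
    ring

/-- By Leibniz, each `N` contributes quotients over `j ∈ M ∩ N`. Averaging kills every `N ≠ M`, so
the monomial of `M` isolates `δ M`. -/
theorem sum_permFrac_deviationField (hn : (n.factorial : K) ≠ 0) {k : ℕ} (hk : 1 ≤ k)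
    (δ : Finset (Fin n) → K) {M : Finset (Fin n)} (hM : #M = k) :
    ∑ σ, permFrac K n σ (deviationField k δ (∏ l ∈ M, X l)) =
      algebraMap _ _ (C (-(δ M * (n.factorial * (-1) ^ (k - 1)))) : MvPolynomial (Fin n) K) := by
  set x : Fin n → RatFun K n := fun l => algebraMap (MvPolynomial (Fin n) K) (RatFun K n) (X l) with hx
  have hxinj : Function.Injective x := algebraMap_X_injective
  have hnL : (n.factorial : RatFun K n) ≠ 0 := by
    have h1 : (n.factorial : RatFun K n) =
        algebraMap (MvPolynomial (Fin n) K) _ (C (n.factorial : K)) := by simp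
    rw [h1]
    intro h
    have h2 := IsFractionRing.injective (MvPolynomial (Fin n) K) (RatFun K n)
      (h.trans (map_zero _).symm)
    exact hn (C_injective _ _ (h2.trans (map_zero C).symm))
  have hpx : ∀ σ l, permFrac K n σ (x l) = x (σ l) := fun σ l => by
    rw [hx, permFrac_algebraMap, rename_X]
  have h1 : deviationField k δ (∏ l ∈ M, X l) = -∑ N ∈ powersetCard k univ,
      algebraMap _ _ (C (δ N) : MvPolynomial (Fin n) K) *
        ∑ j ∈ M ∩ N, (∏ l ∈ M.erase j, x l) / ∏ l ∈ N.erase j, (x j - x l) := by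
    rw [derivation_prod]
    simp only [deviationField, mkDerivation_X, mul_neg, sum_neg_distrib, mul_sum]
    rw [sum_comm]
    congr 1
    refine sum_congr rfl fun N _ => ?_
    rw [← filter_mem_eq_inter, sum_filter]
    refine sum_congr rfl fun j _ => ?_
    split_ifs
    · rw [div_eq_mul_inv]
      ring
    · rw [mul_zero]
  have h2 : ∀ σ, permFrac K n σ (deviationField k δ (∏ l ∈ M, X l)) =
      -∑ N ∈ powersetCard k univ, algebraMap _ _ (C (δ N) : MvPolynomial (Fin n) K) *
        ∑ j ∈ M ∩ N, quotientTerm x σ j (M.erase j) N := by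
    intro σ
    rw [h1, map_neg, map_sum]
    congr 1
    refine sum_congr rfl fun N _ => ?_
    rw [map_mul, permFrac_algebraMap, rename_C, map_sum]
    congr 1
    refine sum_congr rfl fun j _ => ?_
    rw [map_div₀, map_prod, map_prod, quotientTerm]
    simp only [map_sub, hpx]
  simp only [h2]
  rw [sum_neg_distrib, sum_comm]
  simp only [← mul_sum]
  rw [sum_eq_single M]
  · rw [inter_self, sum_comm, sum_quotientTerm_self hxinj (card_pos.mp (by omega)), hM]
    simp
  · intro N hN hNM
    rw [sum_comm, sum_quotientTerm_of_ne hxinj hnL (hM.trans (mem_powersetCard.mp hN).2.symm) hNM,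
      mul_zero]
  · intro h
    exact absurd (mem_powersetCard.mpr ⟨subset_univ _, hM⟩) h

/-- A system with leading part `elem` whose first order deviation is nonzero has a zero different
from the origin. -/
theorem deviation_weight_eq_zero [IsAlgClosed K] (hn : (n.factorial : K) ≠ 0) {k : ℕ} (hk : 1 ≤ k)
    (δ : Finset (Fin n) → K) {g : Fin n → MvPolynomial (Fin n) K}
    (hg : ∀ i : Fin n, g i - elem K n i - (deviation k δ).coeff i ∈
      weightLE (fun _ => (1 : ℤ)) (n - i - k - 1))
    (hzero : ∀ a : Fin n → K, (∀ i, eval a (g i) = 0) → a = 0) {M : Finset (Fin n)}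
    (hM : #M = k) : δ M = 0 := by
  have hG : CoeffWeightLE (n - k) (deviation k δ) := by
    refine CoeffWeightLE.sum _ fun N hN => ?_
    refine ((CoeffWeightLE.C_C (δ N)).mul (coeffWeightLE_complPoly N)).mono ?_
    rw [(mem_powersetCard.mp hN).2]
    omega
  have hf : IsWeightedHomogeneous (fun _ => (1 : ℤ)) (∏ l ∈ M, X l : MvPolynomial (Fin n) K) k := by
    have := IsWeightedHomogeneous.prod M (fun l => (X l : MvPolynomial (Fin n) K))
      (fun _ => (1 : ℤ)) (w := fun _ => (1 : ℤ)) fun l _ => isWeightedHomogeneous_X K _ l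
    rwa [sum_const, hM, nsmul_eq_mul, mul_one] at this
  have h := eq_zero_of_sum_permFrac_derivation (k := k) (by exact_mod_cast hk)
    (fun i => weightLE_mono (by omega) (hG i)) hg hzero hf (deviationField k δ)
    (deviationField_elem hk δ) (sum_permFrac_deviationField hn hk δ hM)
  rw [neg_eq_zero, mul_eq_zero] at h
  exact h.resolve_right (mul_ne_zero hn (pow_ne_zero _ (by simp)))

end VectorField

open MvPolynomial

/-! ### Expansion of the characteristic polynomial in principal minors. -/

section Expansion

theorem det_diagonal_add {R : Type*} [CommRing R] {n : ℕ} (d : Fin n → R)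
    (M : Matrix (Fin n) (Fin n) R) :
    (M + Matrix.diagonal d).det = ∑ N : Finset (Fin n),
      (M.submatrix (Subtype.val : N → Fin n) (Subtype.val : N → Fin n)).det * ∏ l ∈ Nᶜ, d l := by
  let D := (Matrix.detRowAlternating : (Fin n → R) [⋀^Fin n]→ₗ[R] R)
  change D ((fun i => M i) + fun i => Matrix.diagonal d i) = _
  rw [D.map_add_univ]
  refine sum_congr rfl fun N _ => ?_
  have h : N.piecewise (fun i => M i) (fun i => Matrix.diagonal d i) =
      fun i => (if i ∈ N then 1 else d i) •
        N.piecewise M.row (1 : Matrix (Fin n) (Fin n) R).row i := by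
    funext i j
    by_cases hi : i ∈ N
    · simp [hi, Finset.piecewise, Matrix.row]
    · simp [hi, Finset.piecewise, Matrix.row, Matrix.diagonal_apply, Matrix.one_apply]
  rw [h, D.map_smul_univ, smul_eq_mul, mul_comm]
  congr 1
  · exact Matrix.det_piecewise_one_eq_submatrix_det M N
  · rw [prod_ite, prod_const_one, one_mul]
    refine prod_congr ?_ fun _ _ => rfl
    ext i
    simp

/-- The signed principal minors, which are the coefficients in the expansion of the characteristic
polynomial. -/
def signedMinor {R : Type*} [CommRing R] {n : ℕ} (A : Matrix (Fin n) (Fin n) R)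
    (N : Finset (Fin n)) : R :=
  (-1) ^ #N * (A.submatrix (Subtype.val : N → Fin n) (Subtype.val : N → Fin n)).det

theorem charpoly_add_diagonal {R : Type*} [CommRing R] {n : ℕ} (A : Matrix (Fin n) (Fin n) R)
    (x : Fin n → R) :
    (A + Matrix.diagonal x).charpoly =
      ∑ N : Finset (Fin n), Polynomial.C (signedMinor A N) * complPoly x N := by
  have h : (A + Matrix.diagonal x).charmatrix = (-A).map Polynomial.C +
      Matrix.diagonal fun l => Polynomial.X - Polynomial.C (x l) := by
    ext i j : 2
    by_cases hij : i = j
    · subst hij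
      simp [Matrix.charmatrix_apply_eq]
      ring
    · simp [Matrix.charmatrix_apply_ne _ _ _ hij, Matrix.diagonal_apply_ne _ hij]
  rw [Matrix.charpoly, h, det_diagonal_add]
  refine sum_congr rfl fun N _ => ?_
  rw [complPoly, signedMinor]
  congr 1
  rw [Matrix.submatrix_map, Matrix.submatrix_neg, ← RingHom.mapMatrix_apply, ← RingHom.map_det]
  simp only [Pi.neg_apply]
  rw [Matrix.det_neg, Fintype.card_coe]

theorem hasseDeriv_succ_X_sub_C_mul {R : Type*} [CommRing R] (a : R) (q : Polynomial R) (m : ℕ) :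
    Polynomial.hasseDeriv (m + 1) ((Polynomial.X - Polynomial.C a) * q) =
      (Polynomial.X - Polynomial.C a) * Polynomial.hasseDeriv (m + 1) q +
        Polynomial.hasseDeriv m q := by
  ext i
  cases i with
  | zero =>
    simp only [sub_mul, map_sub, Polynomial.hasseDeriv_coeff, Polynomial.coeff_add,
      Polynomial.coeff_sub, Polynomial.coeff_C_mul, Polynomial.coeff_X_mul_zero, zero_add,
      Polynomial.coeff_X_mul, Nat.choose_self]
    ring
  | succ i =>
    simp only [sub_mul, map_sub, Polynomial.hasseDeriv_coeff, Polynomial.coeff_add,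
      Polynomial.coeff_sub, Polynomial.coeff_C_mul, Polynomial.coeff_X_mul]
    rw [← add_assoc (i + 1) m 1, Polynomial.coeff_X_mul, Nat.choose_succ_succ (i + 1 + m) m,
      show i + (m + 1) = i + 1 + m by ring]
    push_cast
    ring

theorem hasseDeriv_prod_X_sub_C {R ι : Type*} [CommRing R] [DecidableEq ι] (x : ι → R)
    (s : Finset ι) (m : ℕ) :
    Polynomial.hasseDeriv m (∏ l ∈ s, (Polynomial.X - Polynomial.C (x l))) =
      ∑ N ∈ powersetCard m s, ∏ l ∈ s \ N, (Polynomial.X - Polynomial.C (x l)) := by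
  induction s using Finset.induction_on generalizing m with
  | empty =>
    cases m with
    | zero => simp
    | succ m => simp [Polynomial.hasseDeriv_apply_one]
  | insert a s ha ih =>
    cases m with
    | zero => simp
    | succ m =>
      rw [prod_insert ha, hasseDeriv_succ_X_sub_C_mul, ih, ih, powersetCard_succ_insert ha,
        sum_union, sum_image, mul_sum]
      · congr 1
        · refine sum_congr rfl fun N hN => ?_
          have haN : a ∉ N := fun h => ha ((mem_powersetCard.mp hN).1 h)
          rw [insert_sdiff_of_notMem _ haN, prod_insert (fun h => ha (mem_sdiff.mp h).1)]
        · refine sum_congr rfl fun N hN => ?_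
          rw [insert_sdiff_insert, sdiff_insert_of_notMem ha]
      · intro N hN N' hN' h
        have haN : a ∉ N := fun h => ha ((mem_powersetCard.mp hN).1 h)
        have haN' : a ∉ N' := fun h => ha ((mem_powersetCard.mp hN').1 h)
        rw [← erase_insert haN, ← erase_insert haN', h]
      · rw [disjoint_left]
        intro N hN hN'
        obtain ⟨N', -, rfl⟩ := mem_image.mp hN'
        exact ha ((mem_powersetCard.mp hN).1 (mem_insert_self a N'))

/-- This makes minors that depend only on their size act through a differential operator on the
single polynomial `∏ (X - x_l)`. -/
theorem sum_complPoly {R : Type*} [CommRing R] {n : ℕ} (x : Fin n → R) (m : ℕ) :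
    ∑ N ∈ powersetCard m univ, complPoly x N = Polynomial.hasseDeriv m (complPoly x ∅) := by
  rw [complPoly, compl_empty, hasseDeriv_prod_X_sub_C]
  refine sum_congr rfl fun N _ => ?_
  rw [complPoly, compl_eq_univ_sdiff]

end Expansion

/-! ### Inverting the differential operator. -/

section HasseOperator

variable {K R : Type*} [Field K] [CommRing R] [Algebra K R]

/-- The operator `∑_{1 ≤ m ≤ k} μ_m ∂^[m]` on polynomials. -/
noncomputable def hasseOp (R : Type*) [CommRing R] [Algebra K R] (μ : ℕ → K) (k : ℕ) :
    Module.End K (Polynomial R) :=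
  ∑ m ∈ Icc 1 k, μ m • (Polynomial.hasseDeriv m : Polynomial R →ₗ[R] _).restrictScalars K

/-- The inverse of `1 + hasseOp R μ k` on polynomials of degree at most `n`. -/
noncomputable def hasseInv (R : Type*) [CommRing R] [Algebra K R] (μ : ℕ → K) (k n : ℕ) :
    Module.End K (Polynomial R) :=
  ∑ j ∈ range (n + 1), (-hasseOp R μ k) ^ j

variable (μ : ℕ → K) (k : ℕ)

theorem coeff_hasseOp (q : Polynomial R) (i : ℕ) : (hasseOp R μ k q).coeff i =
    ∑ m ∈ Icc 1 k, μ m • (((i + m).choose m : R) * q.coeff (i + m)) := by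
  simp [hasseOp, Polynomial.finsetSum_coeff, Polynomial.hasseDeriv_coeff]

theorem one_add_hasseOp_apply (hμ : μ 0 = 1) (q : Polynomial R) :
    (1 + hasseOp R μ k) q = ∑ m ∈ range (k + 1), μ m • Polynomial.hasseDeriv m q := by
  rw [range_eq_Ico, sum_eq_sum_Ico_succ_bot (by omega), hμ, one_smul, Polynomial.hasseDeriv_zero']
  simp [hasseOp]
  rfl

/-- Each application lowers the degree, so the operator is nilpotent on degree at most `n` and the
finite geometric series `hasseInv` inverts `1 + hasseOp` there. -/
theorem coeff_pow_hasseOp_eq_zero {n : ℕ} {q : Polynomial R} (hq : ∀ i, n < i → q.coeff i = 0)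
    (j i : ℕ) (hi : n < i + j) : (((-hasseOp R μ k) ^ j) q).coeff i = 0 := by
  induction j generalizing i with
  | zero => exact hq i hi
  | succ j ih =>
    rw [pow_succ', Module.End.mul_apply, LinearMap.neg_apply, Polynomial.coeff_neg, coeff_hasseOp,
      sum_eq_zero, neg_zero]
    intro m hm
    rw [ih _ (by have := (mem_Icc.mp hm).1; omega), mul_zero, smul_zero]

theorem pow_hasseOp_eq_zero {n : ℕ} {q : Polynomial R} (hq : ∀ i, n < i → q.coeff i = 0) :
    ((-hasseOp R μ k) ^ (n + 1)) q = 0 := by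
  ext i
  rw [coeff_pow_hasseOp_eq_zero μ k hq _ _ (by omega), Polynomial.coeff_zero]

theorem hasseInv_one_add_hasseOp {n : ℕ} {q : Polynomial R} (hq : ∀ i, n < i → q.coeff i = 0) :
    hasseInv R μ k n ((1 + hasseOp R μ k) q) = q := by
  have h := geom_sum_mul_neg (-hasseOp R μ k) (n + 1)
  rw [sub_neg_eq_add] at h
  have := LinearMap.congr_fun h q
  rwa [Module.End.mul_apply, LinearMap.sub_apply, pow_hasseOp_eq_zero μ k hq, sub_zero] at this

theorem one_add_hasseOp_hasseInv {n : ℕ} {q : Polynomial R} (hq : ∀ i, n < i → q.coeff i = 0) :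
    (1 + hasseOp R μ k) (hasseInv R μ k n q) = q := by
  have h := mul_neg_geom_sum (-hasseOp R μ k) (n + 1)
  rw [sub_neg_eq_add] at h
  have := LinearMap.congr_fun h q
  rwa [Module.End.mul_apply, LinearMap.sub_apply, pow_hasseOp_eq_zero μ k hq, sub_zero] at this

theorem coeff_hasseInv_eq_zero {m : ℕ} (n : ℕ) {q : Polynomial R}
    (hq : ∀ i, m ≤ i → q.coeff i = 0) (i : ℕ) (hi : m ≤ i) :
    (hasseInv R μ k n q).coeff i = 0 := by
  rw [hasseInv, LinearMap.sum_apply, Polynomial.finsetSum_coeff]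
  refine sum_eq_zero fun j hj => ?_
  clear hj
  induction j generalizing i with
  | zero => exact hq i hi
  | succ j ih =>
    rw [pow_succ', Module.End.mul_apply, LinearMap.neg_apply, Polynomial.coeff_neg, coeff_hasseOp,
      sum_eq_zero, neg_zero]
    intro m hm
    rw [ih _ (by omega), mul_zero, smul_zero]

theorem hasseOp_map {S : Type*} [CommRing S] [Algebra K S] (f : R →ₐ[K] S) (q : Polynomial R) :
    (hasseOp R μ k q).map f.toRingHom = hasseOp S μ k (q.map f.toRingHom) := by
  ext i
  simp [coeff_hasseOp, Polynomial.coeff_map]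

theorem hasseInv_map {S : Type*} [CommRing S] [Algebra K S] (f : R →ₐ[K] S) (n : ℕ)
    (q : Polynomial R) :
    (hasseInv R μ k n q).map f.toRingHom = hasseInv S μ k n (q.map f.toRingHom) := by
  rw [hasseInv, hasseInv, LinearMap.sum_apply, LinearMap.sum_apply, Polynomial.map_sum]
  refine sum_congr rfl fun j hj => ?_
  clear hj
  induction j with
  | zero => rfl
  | succ j ih =>
    rw [pow_succ', pow_succ', Module.End.mul_apply, Module.End.mul_apply, LinearMap.neg_apply,
      LinearMap.neg_apply, Polynomial.map_neg, hasseOp_map, ih]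

theorem CoeffWeightLE.hasseOp {n : ℕ} {m : ℤ} {q : Polynomial (MvPolynomial (Fin n) K)}
    (hq : CoeffWeightLE m q) : CoeffWeightLE (m - 1) (hasseOp _ μ k q) := fun i => by
  rw [coeff_hasseOp]
  refine sum_mem fun t ht => Submodule.smul_mem _ _ ?_
  have ht1 := (mem_Icc.mp ht).1
  rw [← nsmul_eq_mul]
  exact nsmul_mem (weightLE_mono (by push_cast; omega) (hq (i + t))) _

/-- Hasse derivatives lower the power of `X` without raising the weight of the coefficients. Hence
the inverse operator leaves the leading part of the deviation intact. -/
theorem CoeffWeightLE.hasseInv_sub {n : ℕ} {m : ℤ} (N : ℕ)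
    {q : Polynomial (MvPolynomial (Fin n) K)} (hq : CoeffWeightLE m q) :
    CoeffWeightLE (m - 1) (hasseInv _ μ k N q - q) := by
  have hneg : ∀ {m : ℤ} {p : Polynomial (MvPolynomial (Fin n) K)}, CoeffWeightLE m p →
      CoeffWeightLE (m - 1) ((-ArtinBasis.hasseOp _ μ k) p) := by
    intro m p hp i
    rw [LinearMap.neg_apply, Polynomial.coeff_neg]
    exact neg_mem (hp.hasseOp μ k i)
  have hpow : ∀ j : ℕ, CoeffWeightLE (m - j) (((-ArtinBasis.hasseOp _ μ k) ^ j) q) := by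
    intro j
    induction j with
    | zero => simpa using hq
    | succ j ih =>
      rw [pow_succ', Module.End.mul_apply]
      exact (hneg ih).mono (by push_cast; omega)
  have h : hasseInv _ μ k N q - q =
      ∑ j ∈ range N, ((-ArtinBasis.hasseOp _ μ k) ^ (j + 1)) q := by
    rw [hasseInv, LinearMap.sum_apply, sum_range_succ', pow_zero, Module.End.one_apply,
      add_sub_cancel_right]
  rw [h]
  exact CoeffWeightLE.sum _ fun j _ => (hpow (j + 1)).mono (by push_cast; omega)

end HasseOperator

open MvPolynomial

/-! ### Means of the signed minors. -/

section Minors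

variable {K : Type*} [Field K] {n : ℕ} (A : Matrix (Fin n) (Fin n) K)

/-- The mean of the signed principal minors of size `m`. -/
noncomputable def minorMean (m : ℕ) : K :=
  (∑ N ∈ powersetCard m univ, signedMinor A N) / (n.choose m : K)

theorem minorMean_zero : minorMean A 0 = 1 := by
  simp [minorMean, signedMinor]

theorem signedMinor_eq_of_principalMinorsEqual {k : ℕ}
    (h : SpectralRigidity.PrincipalMinorsEqual A k) {N M : Finset (Fin n)} (hN : #N = k)
    (hM : #M = k) : signedMinor A N = signedMinor A M := by
  rw [signedMinor, signedMinor, hN, hM]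
  congr 1
  exact h N M hN hM

theorem principalMinorsEqual_of_signedMinor {k : ℕ}
    (h : ∀ N M : Finset (Fin n), #N = k → #M = k → signedMinor A N = signedMinor A M) :
    SpectralRigidity.PrincipalMinorsEqual A k := by
  intro N M hN hM
  have := h N M hN hM
  rw [signedMinor, signedMinor, hN, hM] at this
  exact mul_left_cancel₀ (pow_ne_zero _ (by simp)) this

variable (hn : (n.factorial : K) ≠ 0)

include hn

theorem choose_cast_ne_zero {m : ℕ} (hm : m ≤ n) : (n.choose m : K) ≠ 0 := by
  intro h
  apply hn
  rw [← Nat.choose_mul_factorial_mul_factorial hm, Nat.cast_mul, Nat.cast_mul, h, zero_mul,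
    zero_mul]

/-- The deviations from the mean cancel at `v = 0`, where all `complPoly` of one size coincide; so
subtracting the value at the origin leaves the deviation term unchanged. -/
theorem sum_signedMinor_sub_mean {m : ℕ} (hm : m ≤ n) :
    ∑ N ∈ powersetCard m univ, (signedMinor A N - minorMean A m) = 0 := by
  rw [sum_sub_distrib, sum_const, card_powersetCard, card_univ, Fintype.card_fin, nsmul_eq_mul,
    minorMean, mul_div_cancel₀ _ (choose_cast_ne_zero hn hm), sub_self]

theorem signedMinor_eq_mean {k : ℕ} (h : SpectralRigidity.PrincipalMinorsEqual A k)
    {N : Finset (Fin n)} (hN : #N = k) : signedMinor A N = minorMean A k := by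
  have hk : k ≤ n := by
    rw [← hN]
    simpa using card_le_univ N
  have hs : ∑ M ∈ powersetCard k univ, signedMinor A M = (n.choose k : K) * signedMinor A N := by
    rw [sum_congr rfl fun M hM =>
      signedMinor_eq_of_principalMinorsEqual A h (mem_powersetCard.mp hM).2 hN, sum_const,
      card_powersetCard, card_univ, Fintype.card_fin, nsmul_eq_mul]
  rw [minorMean, hs, mul_div_cancel_left₀ _ (choose_cast_ne_zero hn hk)]

end Minors

/-! ### Rigidity and the translation to spectra and ideals. -/

section Main

variable {K : Type*} [Field K] {n : ℕ} (A : Matrix (Fin n) (Fin n) K)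

theorem sum_powerset_eq {M : Type*} [AddCommMonoid M] (F : Finset (Fin n) → M) :
    ∑ N : Finset (Fin n), F N = ∑ m ∈ range (n + 1), ∑ N ∈ powersetCard m univ, F N := by
  rw [← powerset_univ, sum_powerset, card_univ, Fintype.card_fin]

theorem natDegree_complPoly_empty {R : Type*} [CommRing R] [Nontrivial R] (x : Fin n → R) :
    (complPoly x ∅).natDegree = n := by
  rw [complPoly, Polynomial.natDegree_prod_of_monic _ _ fun _ _ => Polynomial.monic_X_sub_C _]
  simp

/-- The part of the characteristic polynomial coming from the minors of size at most `k`, if these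
are replaced by their means. -/
theorem sum_mean_mul_complPoly {R : Type*} [CommRing R] [Algebra K R] (x : Fin n → R) (k : ℕ) :
    ∑ m ∈ range (k + 1), ∑ N ∈ powersetCard m univ,
      Polynomial.C (algebraMap K R (minorMean A m)) * complPoly x N =
      (1 + hasseOp R (minorMean A) k) (complPoly x ∅) := by
  rw [one_add_hasseOp_apply _ _ (minorMean_zero A)]
  refine sum_congr rfl fun m _ => ?_
  rw [← mul_sum, sum_complPoly, ← Polynomial.smul_eq_C_mul, algebraMap_smul]

theorem complPoly_zero {R : Type*} [CommRing R] (N : Finset (Fin n)) :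
    complPoly (0 : Fin n → R) N = Polynomial.X ^ (n - #N) := by
  simp [complPoly, card_compl]

theorem charpoly_map_add_diagonal {R : Type*} [CommRing R] [Algebra K R] (x : Fin n → R) :
    (A.map (algebraMap K R) + Matrix.diagonal x).charpoly = ∑ m ∈ range (n + 1),
      ∑ N ∈ powersetCard m univ,
        Polynomial.C (algebraMap K R (signedMinor A N)) * complPoly x N := by
  rw [charpoly_add_diagonal, sum_powerset_eq]
  refine sum_congr rfl fun m _ => sum_congr rfl fun N _ => ?_
  congr 2
  rw [signedMinor, signedMinor, map_mul (algebraMap K R), map_pow, map_neg, map_one,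
    RingHom.map_det]
  rfl

theorem eq_zero_of_complPoly_eq {x : Fin n → K}
    (h : complPoly x ∅ = complPoly (0 : Fin n → K) ∅) : x = 0 := by
  funext i
  have h1 := congrArg (Polynomial.eval (x i)) h
  rw [complPoly_zero, complPoly, Polynomial.eval_prod, prod_eq_zero (mem_compl.mpr
    (notMem_empty i)) (by simp), Polynomial.eval_pow, Polynomial.eval_X] at h1
  exact (pow_eq_zero_iff (by simpa using i.pos.ne')).mp h1.symm

/-- Both characteristic polynomials are images of monic polynomials of degree `n` under one
injective operator, so `∏ (X - x_l) = X ^ n`. -/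
theorem eq_zero_of_charpoly_add_diagonal_eq (hn : (n.factorial : K) ≠ 0)
    (hA : SpectralRigidity.HasSymmetrizedPrincipalMinors A) {x : Fin n → K}
    (hx : (A + Matrix.diagonal x).charpoly = A.charpoly) : x = 0 := by
  have h : ∀ x : Fin n → K, (A + Matrix.diagonal x).charpoly =
      (1 + hasseOp K (minorMean A) n) (complPoly x ∅) := by
    intro x
    rw [← sum_mean_mul_complPoly]
    refine (charpoly_map_add_diagonal A (R := K) x).trans ?_
    refine sum_congr rfl fun m _ => sum_congr rfl fun N hN => ?_
    rw [signedMinor_eq_mean A hn (hA m) (mem_powersetCard.mp hN).2]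
  have h0 : A.charpoly = (1 + hasseOp K (minorMean A) n) (complPoly (0 : Fin n → K) ∅) := by
    rw [← h]
    simp
  rw [h0, h] at hx
  have hdeg : ∀ (x : Fin n → K) i, n < i → (complPoly x ∅).coeff i = 0 := fun x i hi =>
    Polynomial.coeff_eq_zero_of_natDegree_lt (by rwa [natDegree_complPoly_empty])
  apply eq_zero_of_complPoly_eq
  rw [← hasseInv_one_add_hasseOp (minorMean A) n (hdeg x), hx,
    hasseInv_one_add_hasseOp (minorMean A) n (hdeg 0)]

/-- The part of the characteristic polynomial coming from the minors of size more than `k`. -/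
noncomputable def highPart {R : Type*} [CommRing R] [Algebra K R] (k : ℕ) (x : Fin n → R) :
    Polynomial R :=
  ∑ m ∈ Ico (k + 1) (n + 1), ∑ N ∈ powersetCard m univ,
    Polynomial.C (algebraMap K R (signedMinor A N)) * complPoly x N

theorem charpoly_eq_mean_add_deviation {R : Type*} [CommRing R] [Algebra K R]
    (hn : (n.factorial : K) ≠ 0) {k : ℕ} (hkn : k ≤ n)
    (hlow : ∀ m < k, SpectralRigidity.PrincipalMinorsEqual A m) (x : Fin n → R) :
    (A.map (algebraMap K R) + Matrix.diagonal x).charpoly =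
      (1 + hasseOp R (minorMean A) k) (complPoly x ∅) +
      ∑ N ∈ powersetCard k univ,
        Polynomial.C (algebraMap K R (signedMinor A N - minorMean A k)) * complPoly x N +
      highPart A k x := by
  rw [charpoly_map_add_diagonal, range_eq_Ico,
    ← sum_Ico_consecutive _ (Nat.zero_le (k + 1)) (by omega : k + 1 ≤ n + 1), ← range_eq_Ico,
    ← sum_mean_mul_complPoly, sum_range_succ, sum_range_succ, highPart]
  congr 1
  rw [add_assoc, ← sum_add_distrib]
  congr 1
  · refine sum_congr rfl fun m hm => sum_congr rfl fun N hN => ?_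
    rw [signedMinor_eq_mean A hn (hlow m (mem_range.mp hm)) (mem_powersetCard.mp hN).2]
  · refine sum_congr rfl fun N _ => ?_
    rw [← add_mul, ← Polynomial.C_add, ← map_add, add_sub_cancel]

theorem sum_deviation_zero {R : Type*} [CommRing R] [Algebra K R] (hn : (n.factorial : K) ≠ 0)
    {k : ℕ} (hkn : k ≤ n) :
    ∑ N ∈ powersetCard k univ, Polynomial.C (algebraMap K R (signedMinor A N - minorMean A k)) *
      complPoly (0 : Fin n → R) N = 0 := by
  rw [sum_congr rfl fun N hN => by rw [complPoly_zero, (mem_powersetCard.mp hN).2], ← sum_mul,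
    ← map_sum, ← map_sum, sum_signedMinor_sub_mean A hn hkn, map_zero, map_zero, zero_mul]

theorem coeffWeightLE_highPart_sub (k : ℕ) : CoeffWeightLE (n - k - 1)
    (highPart A k (X : Fin n → MvPolynomial (Fin n) K) - highPart A k 0) := by
  refine CoeffWeightLE.sub ?_ ?_
  · refine CoeffWeightLE.sum _ fun m hm => CoeffWeightLE.sum _ fun N hN => ?_
    refine ((CoeffWeightLE.C_C (signedMinor A N)).mul (coeffWeightLE_complPoly N)).mono ?_
    rw [(mem_powersetCard.mp hN).2]
    have := (mem_Ico.mp hm).1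
    omega
  · refine CoeffWeightLE.sum _ fun m hm => CoeffWeightLE.sum _ fun N hN => ?_
    rw [complPoly_zero, (mem_powersetCard.mp hN).2]
    refine ((CoeffWeightLE.C_C (signedMinor A N)).mul (CoeffWeightLE.X.pow (n - m))).mono ?_
    have := mem_Ico.mp hm
    omega

theorem principalMinorsEqual_succ [IsAlgClosed K] (hn : (n.factorial : K) ≠ 0) {k : ℕ} (hk : 1 ≤ k)
    (hkn : k ≤ n) (hlow : ∀ m < k, SpectralRigidity.PrincipalMinorsEqual A m)
    (hzero : ∀ x : Fin n → K, (A + Matrix.diagonal x).charpoly = A.charpoly → x = 0) :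
    SpectralRigidity.PrincipalMinorsEqual A k := by
  set μ := minorMean A with hμ
  set δ : Finset (Fin n) → K := fun N => signedMinor A N - μ k with hδ
  set q : Polynomial (MvPolynomial (Fin n) K) :=
    (A.map (algebraMap K (MvPolynomial (Fin n) K)) + Matrix.diagonal X).charpoly -
    A.charpoly.map (algebraMap K (MvPolynomial (Fin n) K)) with hq
  have hA0 : A.charpoly.map (algebraMap K (MvPolynomial (Fin n) K)) =
      (A.map (algebraMap K (MvPolynomial (Fin n) K)) +
        Matrix.diagonal (0 : Fin n → MvPolynomial (Fin n) K)).charpoly := by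
    rw [Matrix.diagonal_zero', add_zero, Matrix.charpoly_map]
  set H := highPart A (R := MvPolynomial (Fin n) K) k with hH
  have hexp : ∀ x : Fin n → MvPolynomial (Fin n) K,
      (A.map (algebraMap K (MvPolynomial (Fin n) K)) + Matrix.diagonal x).charpoly =
      (1 + hasseOp (MvPolynomial (Fin n) K) μ k) (complPoly x ∅) +
      ∑ N ∈ powersetCard k univ,
        Polynomial.C (algebraMap K (MvPolynomial (Fin n) K) (δ N)) * complPoly x N + H x :=
    charpoly_eq_mean_add_deviation A hn hkn hlow
  have hδ0 : ∑ N ∈ powersetCard k univ,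
      Polynomial.C (algebraMap K (MvPolynomial (Fin n) K) (δ N)) *
        complPoly (0 : Fin n → MvPolynomial (Fin n) K) N = 0 :=
    sum_deviation_zero A hn hkn
  have hqexp : q = (1 + hasseOp (MvPolynomial (Fin n) K) μ k)
      (complPoly X ∅ - complPoly 0 (∅ : Finset (Fin n))) + deviation k δ +
      (H X - H 0) := by
    rw [hq, hA0, hexp, hexp, hδ0, map_sub, deviation]
    simp only [algebraMap_eq]
    ring
  have hdegX : ∀ i, n < i → (complPoly (X : Fin n → MvPolynomial (Fin n) K) ∅ -
      complPoly 0 (∅ : Finset (Fin n))).coeff i = 0 := by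
    intro i hi
    rw [Polynomial.coeff_sub,
      Polynomial.coeff_eq_zero_of_natDegree_lt (by rwa [natDegree_complPoly_empty]),
      Polynomial.coeff_eq_zero_of_natDegree_lt (by rwa [natDegree_complPoly_empty]), sub_zero]
  have hwdev : CoeffWeightLE (n - k) (deviation k δ) := by
    refine CoeffWeightLE.sum _ fun N hN => ?_
    refine ((CoeffWeightLE.C_C (δ N)).mul (coeffWeightLE_complPoly N)).mono ?_
    rw [(mem_powersetCard.mp hN).2]
    omega
  have hwH : CoeffWeightLE (n - k - 1) (H X - H 0) := coeffWeightLE_highPart_sub A k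
  -- Undoing the operator removes all symmetrized terms, so the coefficients of `p` are `elem` plus
  -- the deviation plus lower weight.
  set p := hasseInv (MvPolynomial (Fin n) K) μ k n q with hp
  have hpexp : CoeffWeightLE (n - k - 1)
      (p - (complPoly X ∅ - complPoly 0 (∅ : Finset (Fin n))) - deviation k δ) := by
    have h1 : p - (complPoly X ∅ - complPoly 0 (∅ : Finset (Fin n))) - deviation k δ =
        (hasseInv (MvPolynomial (Fin n) K) μ k n (deviation k δ) - deviation k δ) +
        ((hasseInv (MvPolynomial (Fin n) K) μ k n (H X - H 0) - (H X - H 0)) + (H X - H 0)) := by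
      rw [hp, hqexp, map_add, map_add, hasseInv_one_add_hasseOp μ k hdegX]
      ring
    rw [h1]
    exact (hwdev.hasseInv_sub μ k n).add (((hwH.hasseInv_sub μ k n).mono (by omega)).add hwH)
  have hzero' : ∀ a : Fin n → K, (∀ i : Fin n, eval a (p.coeff i) = 0) → a = 0 := by
    intro a ha
    apply hzero
    set f : (MvPolynomial (Fin n) K) →ₐ[K] K := aeval a with hf
    have hqa : q.map f.toRingHom = (A + Matrix.diagonal a).charpoly - A.charpoly := by
      rw [hq, Polynomial.map_sub, ← Matrix.charpoly_map, Polynomial.map_map]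
      congr 2
      · ext i j
        by_cases hij : i = j
        · subst hij
          simp [hf]
        · simp [hf, Matrix.diagonal_apply_ne _ hij]
      · have : f.toRingHom.comp (algebraMap K (MvPolynomial (Fin n) K)) = RingHom.id K := by
          ext c
          simp [hf]
        rw [this, Polynomial.map_id]
    -- Both characteristic polynomials are monic of degree `n`, so the `n` lower coefficients of `p`
    -- at `a` determine the whole difference.
    have hdeg : ∀ i, n ≤ i → (q.map f.toRingHom).coeff i = 0 := by
      intro i hi
      rw [hqa, Polynomial.coeff_sub]
      rcases hi.eq_or_lt with rfl | hi
      · have h1 : ∀ B : Matrix (Fin n) (Fin n) K, B.charpoly.coeff n = 1 := fun B => by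
          have := B.charpoly_monic
          rwa [Polynomial.Monic, Polynomial.leadingCoeff, Matrix.charpoly_natDegree_eq_dim,
            Fintype.card_fin] at this
        rw [h1, h1, sub_self]
      · rw [Polynomial.coeff_eq_zero_of_natDegree_lt, Polynomial.coeff_eq_zero_of_natDegree_lt,
          sub_zero]
        all_goals rwa [Matrix.charpoly_natDegree_eq_dim, Fintype.card_fin]
    have hinv : hasseInv K μ k n (q.map f.toRingHom) = 0 := by
      ext i
      rw [Polynomial.coeff_zero]
      rcases lt_or_ge i n with hi | hi
      · rw [← hasseInv_map, Polynomial.coeff_map]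
        exact ha ⟨i, hi⟩
      · exact coeff_hasseInv_eq_zero μ k n hdeg i hi
    have h0 := one_add_hasseOp_hasseInv μ k (n := n) fun i hi => hdeg i hi.le
    rw [hinv, map_zero, hqa] at h0
    exact sub_eq_zero.mp h0.symm
  have hmain : ∀ M : Finset (Fin n), #M = k → δ M = 0 := fun M hM =>
    deviation_weight_eq_zero hn hk δ (g := fun i => p.coeff i) (fun i => by
      have h1 := hpexp i
      have h2 : (complPoly (X : Fin n → MvPolynomial (Fin n) K) ∅ -
          complPoly 0 (∅ : Finset (Fin n))).coeff i = elem K n i := by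
        rw [Polynomial.coeff_sub, complPoly_zero, card_empty, Nat.sub_zero, Polynomial.coeff_X_pow,
          if_neg i.2.ne, sub_zero, complPoly, compl_empty]
        rfl
      rw [Polynomial.coeff_sub, Polynomial.coeff_sub, h2] at h1
      exact weightLE_mono (by omega) h1) hzero' hM
  refine principalMinorsEqual_of_signedMinor A fun N M hN hM => ?_
  rw [sub_eq_zero.mp (hmain N hN), sub_eq_zero.mp (hmain M hM)]

/-- The only diagonal perturbation preserving the characteristic polynomial of `A` is zero if and
only if `A` has symmetrized principal minors. -/
theorem charpoly_rigid_iff [IsAlgClosed K] (hn : (n.factorial : K) ≠ 0) :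
    (∀ x : Fin n → K, (A + Matrix.diagonal x).charpoly = A.charpoly → x = 0) ↔
      SpectralRigidity.HasSymmetrizedPrincipalMinors A := by
  refine ⟨fun hzero k => ?_, fun hA x hx => eq_zero_of_charpoly_add_diagonal_eq A hn hA hx⟩
  induction k using Nat.strong_induction_on with
  | _ k ih =>
    rcases Nat.eq_zero_or_pos k with rfl | hk
    · intro N M hN hM
      rw [card_eq_zero.mp hN, card_eq_zero.mp hM]
    · by_cases hkn : k ≤ n
      · exact principalMinorsEqual_succ A hn hk hkn ih hzero
      · intro N M hN
        have := card_le_univ N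
        rw [Fintype.card_fin] at this
        omega

theorem factorial_ne_zero_of_ringChar (h : ringChar K = 0 ∨ n < ringChar K) :
    (n.factorial : K) ≠ 0 := by
  intro h0
  rw [ringChar.spec] at h0
  rcases h with h | h
  · rw [h, zero_dvd_iff] at h0
    exact Nat.factorial_ne_zero n h0
  · have hp : (ringChar K).Prime :=
      (CharP.char_is_prime_or_zero K (ringChar K)).resolve_right (by omega)
    have := hp.dvd_factorial.mp h0
    omega

/-- A monic polynomial over an algebraically closed field is the product of its linear factors,
hence is determined by its multiset of roots. -/
theorem isospectral_iff [IsAlgClosed K] (B : Matrix (Fin n) (Fin n) K) :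
    SpectralRigidity.Isospectral A B ↔ A.charpoly = B.charpoly := by
  refine ⟨fun h => ?_, fun h => by rw [SpectralRigidity.Isospectral,
    SpectralRigidity.spectrumMultiset, SpectralRigidity.spectrumMultiset, h]⟩
  have h1 : A.charpoly.roots = B.charpoly.roots := h
  rw [(IsAlgClosed.splits A.charpoly).eq_prod_roots_of_monic A.charpoly_monic,
    (IsAlgClosed.splits B.charpoly).eq_prod_roots_of_monic B.charpoly_monic, h1]

theorem eval_charCoeff (x : Fin n → K) (i : ℕ) :
    eval x (SpectralRigidity.charCoeff A i) =
      (-1) ^ i * (A + Matrix.diagonal x).charpoly.coeff (n - i) := by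
  have h : (SpectralRigidity.genericShift A).map (eval x) = A + Matrix.diagonal x := by
    ext a b
    by_cases hab : a = b
    · subst hab
      simp [SpectralRigidity.genericShift]
    · simp [SpectralRigidity.genericShift, Matrix.diagonal_apply_ne _ hab]
  rw [SpectralRigidity.charCoeff, map_mul, map_pow, map_neg, map_one, ← h, Matrix.charpoly_map,
    Polynomial.coeff_map]

theorem mem_zeroLocus_spectralIdeal_iff (x : Fin n → K) :
    x ∈ zeroLocus K (SpectralRigidity.spectralIdeal A) ↔
      (A + Matrix.diagonal x).charpoly = A.charpoly := by
  have hinv : ∀ i, eval x (SpectralRigidity.spectralInvariant A i) =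
      (-1) ^ i * ((A + Matrix.diagonal x).charpoly.coeff (n - i) - A.charpoly.coeff (n - i)) := by
    intro i
    rw [SpectralRigidity.spectralInvariant, map_sub, eval_C, eval_charCoeff, eval_charCoeff,
      Matrix.diagonal_zero', add_zero, mul_sub]
  rw [SpectralRigidity.spectralIdeal, zeroLocus_span]
  simp only [Set.mem_ofPred_eq, Set.forall_mem_image, aeval_eq_eval]
  constructor
  · intro h
    ext j
    have hmon : ∀ B : Matrix (Fin n) (Fin n) K, B.charpoly.coeff n = 1 := fun B => by
      have := B.charpoly_monic
      rwa [Polynomial.Monic, Polynomial.leadingCoeff, Matrix.charpoly_natDegree_eq_dim,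
        Fintype.card_fin] at this
    rcases lt_trichotomy j n with hj | rfl | hj
    · have h1 := h (x := n - j) ⟨by omega, by omega⟩
      rw [hinv, show n - (n - j) = j by omega, mul_eq_zero] at h1
      exact sub_eq_zero.mp (h1.resolve_left (pow_ne_zero _ (by simp)))
    · rw [hmon, hmon]
    · rw [Polynomial.coeff_eq_zero_of_natDegree_lt, Polynomial.coeff_eq_zero_of_natDegree_lt]
      all_goals rwa [Matrix.charpoly_natDegree_eq_dim, Fintype.card_fin]
  · intro h i _
    rw [hinv, h, sub_self, mul_zero]

end Main

end ArtinBasis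

theorem theoremA {K : Type*} [Field K] [IsAlgClosed K] (n : ℕ)
    (hchar : ringChar K = 0 ∨ n < ringChar K) (A : Matrix (Fin n) (Fin n) K) :
    ((∃ D : Matrix (Fin n) (Fin n) K,
        D.IsDiag ∧ D ≠ 0 ∧ SpectralRigidity.Isospectral A (A + D)) ↔
      ∃ k : ℕ, ¬ SpectralRigidity.PrincipalMinorsEqual A k) ∧
    (MvPolynomial.zeroLocus K (SpectralRigidity.spectralIdeal A) = {0} ↔
      SpectralRigidity.HasSymmetrizedPrincipalMinors A) := by
  have hrigid := ArtinBasis.charpoly_rigid_iff A (ArtinBasis.factorial_ne_zero_of_ringChar hchar)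
  constructor
  · rw [← not_iff_not]
    push Not
    rw [← SpectralRigidity.HasSymmetrizedPrincipalMinors, ← hrigid]
    constructor
    · intro h x hx
      by_contra hx0
      exact h (Matrix.diagonal x) (Matrix.isDiag_diagonal x)
        (fun h0 => hx0 (Matrix.diagonal_eq_zero.mp h0))
        ((ArtinBasis.isospectral_iff A _).mpr hx.symm)
    · intro h D hD hD0 hiso
      obtain ⟨x, rfl⟩ : ∃ x, D = Matrix.diagonal x :=
        ⟨D.diag, ((Matrix.isDiag_iff_diagonal_diag D).mp hD).symm⟩
      exact hD0 (Matrix.diagonal_eq_zero.mpr (h _ ((ArtinBasis.isospectral_iff A _).mp hiso).symm))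
  · rw [← hrigid, Set.eq_singleton_iff_unique_mem]
    simp only [ArtinBasis.mem_zeroLocus_spectralIdeal_iff]
    refine ⟨fun h => h.2, fun h => ⟨?_, h⟩⟩
    rw [Matrix.diagonal_zero', add_zero]
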